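/- \textbf{Setting.} All Banach spaces are over $\mathbb K\in\{\mathbb R,\mathbb C\}$, operators are bounded and linear, $\mathbb N=\{1,2,\dots\}$, and $[L]$ is the set of infinite subsets of $L\subset\mathbb N$. Finite subsets of $\mathbb N$ are identified with their increasing enumerations; $E<F$ means that every element of $E$ is smaller than every element of $F$, $E\preceq F$ that $E$ is an initial segment of $F$, and $E\prec F$ that moreover $E\ne F$. For a family $\mathcal F$ of finite subsets of $\mathbb N$, $MAX(\mathcal F)$ is the set of $\preceq$-maximal members of $\mathcal F$, and $$\mathcal F[\mathcal G]=\{\varnothing\}\cup\Bigl\{\bigcup_{n=1}^m E_n: E_1<\dots<E_m,\ \varnothing\ne E_n\in\mathcal G,\ \{\min E_1,\dots,\min E_m\}\in\mathcal F\Bigr\}.$$ \textbf{Schreier families.} Choose for every countable limit ordinal $\xi$ a sequence $\xi_1<\xi_2<\cdots$ with supremum $\xi$. Let $\mathcal S_0=\{\varnothing\}\cup\{\{n\}:n\in\mathbb N\}$; let $\mathcal S_{\xi+1}$ consist of $\varnothing$ and all unions $E_1\cup\dots\cup E_m$ with $E_1<\dots<E_m$, $\varnothing\ne E_n\in\mathcal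 S_\xi$ and $m\le\min E_1$; for countable limit $\xi$ let $\mathcal S_\xi$ consist of $\varnothing$ and all $E$ such that $n\le\min E$ and $E\in\mathcal S_{\xi_n+1}$ for some $n$. The choice is assumed to be such that $\mathcal S_{\xi_n+1}\subset\mathcal S_{\xi_{n+1}}$ for all countable limit ordinals $\xi$ and all $n$ (such choices exist). For $\mathcal F=\mathcal S_\xi$ or $\mathcal F=\mathcal S_\zeta[\mathcal S_\xi]$, every $N\in[\mathbb N]$ is uniquely a union of successive members $E_1<E_2<\cdots$ of $MAX(\mathcal F)$; put $N|_n^{\mathcal F}=E_1\cup\dots\cup E_n$. Likewise every non-empty finite $E$ is uniquely $E_1\cup\dots\cup E_m$ with $E_1<\dots<E_m$, $E_n\in MAX(\mathcal F)$ for $n<m$ and $\varnothing\ne E_m\in\mathcal F$; put $\ell_{\mathcal F}(E)=E_m$. \textbf{Weights.} For non-empty finite $E$ let $p^0_E=1$; $p^{\xi+1}_E=p^\xi_{\ell_{\mathcal S_\xi}(G)}/\min G$ with $G=\ell_{\mathcal S_{\xi+1}}(E)$; and, for limit $\xi$, $p^\xi_E=p^{\xi_{\min G}+1}_G$ with $G=\ell_{\mathcal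 S_\xi}(E)$. Let $q^{\xi,0}_E=1$; $q^{\xi,\zeta+1}_E=q^{\xi,\zeta}_{\ell_{\mathcal S_\zeta[\mathcal S_\xi]}(G)}/\sqrt{\min G}$ with $G=\ell_{\mathcal S_{\zeta+1}[\mathcal S_\xi]}(E)$; and, for limit $\zeta$, $q^{\xi,\zeta}_E=q^{\xi,\zeta_{\min G}+1}_G$ with $G=\ell_{\mathcal S_\zeta[\mathcal S_\xi]}(E)$. For $\mathfrak u=(u_E)_{\varnothing\ne E}$ in a Banach space (indexed by the non-empty finite $E\subset\mathbb N$) put $$\mathbb E_{\xi,N}\mathfrak u(n)=\sum_{N|^{\mathcal S_\xi}_{n-1}\prec E\preceq N|^{\mathcal S_\xi}_n}p^\xi_Eu_E,\qquad \mathbb E^{(2)}_{\xi,\zeta,N}\mathfrak u(n)=\sum_{N|^{\mathcal S_\zeta[\mathcal S_\xi]}_{n-1}\prec E\preceq N|^{\mathcal S_\zeta[\mathcal S_\xi]}_n}q^{\xi,\zeta}_Ep^\xi_Eu_E .$$ \textbf{The properties.} Let $\|(v_n)\|_p^w=\sup_{\|f\|\le1}(\sum_n|f(v_n)|^p)^{1/p}\in[0,\infty]$,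 the supremum being over functionals $f$. Call $\mathfrak u$ weakly null if for every finite $F\subset\mathbb N$ the sequence $(u_{F\cup\{k\}})_{k>\max F}$ is weakly null. An operator $A:U\to V$ has the $\gamma$-$S_\xi$ (resp. $\gamma$-$G_{\xi,\zeta}$) Property, $\gamma\in[0,\infty)$, if for every weakly null $\mathfrak u$ in the closed unit ball $B_U$ and every $L\in[\mathbb N]$ there is $M\in[L]$ with $\|(A\,\mathbb E_{\xi,M}\mathfrak u(n))_n\|_2^w\le\gamma$ (resp. $\|(A\,\mathbb E^{(2)}_{\xi,\zeta,M}\mathfrak u(n))_n\|_1^w\le\gamma$). Let $\mathfrak s_\xi(A)$ (resp. $\mathfrak g_{\xi,\zeta}(A)$) be the infimum of such $\gamma$ ($\infty$ if there are none), and let $\mathfrak S_\xi$ (resp. $\mathfrak G_{\xi,\zeta}$) be the class of all operators between Banach spaces having the property for some $\gamma<\infty$. A Banach space has the property if its identity operator belongs to the class. \textbf{Lemma.} Let $\xi,\zeta<\omega_1$. The following hold for $(\mathfrak s,\mathfrak S)=(\mathfrak s_\xi,\mathfrak S_\xi)$ and for $(\mathfrak s,\mathfrak S)=(\mathfrak g_{\xi,\zeta},\mathfrak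 G_{\xi,\zeta})$. (i) $\mathfrak s(A+B)\le\mathfrak s(A)+\mathfrak s(B)$ for all operators $A,B:U\to V$ between Banach spaces. (ii) $\mathfrak S$ is an operator ideal: each component $\mathfrak S(U,V)$ is a linear space containing the finite rank operators, and $ABC\in\mathfrak S$ whenever $B\in\mathfrak S$ and $A,C$ are operators for which the composition is defined; moreover $\mathfrak s(ABC)\le\|A\|\,\mathfrak s(B)\,\|C\|$ (with $0\cdot\infty=0$). All compact operators between Banach spaces belong to $\mathfrak S$. (iii) If $A:U\to V$ is an operator, $X$ is a Banach space containing no isomorphic copy of $\ell_1$ and $Q:X\to U$ is a surjective operator with $AQ\in\mathfrak S$, then $A\in\mathfrak S$. (iv) If $A:U\to V$ is an operator, $X$ is a Banach space and $j:V\to X$ is an isomorphic embedding with $jA\in\mathfrak S$, then $A\in\mathfrak S$. (v) Consequently, if $U$ and $V$ are isomorphic Banach spaces, then $U$ has the property if and only if $V$ does; and if $X$ contains no isomorphic copy of $\ell_1$ and has the property, then so does every closed subspace of every quotient of $X$ by a closed subspace. -/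

import Mathlib

open Ordinal Topology Filter
open scoped NNReal ENNReal

noncomputable section

namespace RepeatedAverages

/-! ## Finite subsets of the positive integers -/

/-- `E < F`: every element of `E` is smaller than every element of `F`
(automatic if one of the two sets is empty). -/
def Before (E F : Finset ℕ+) : Prop := ∀ a ∈ E, ∀ b ∈ F, a < b

/-- `E ≼ F`: the increasing enumeration of `E` is an initial segment of that of `F`. -/
def InitSeg (E F : Finset ℕ+) : Prop := E ⊆ F ∧ ∀ a ∈ E, ∀ b ∈ F, b ≤ a → b ∈ E

/-- `E ≺ F`: proper initial segment. -/
def ProperInitSeg (E F : Finset ℕ+) : Prop := InitSeg E F ∧ E ≠ F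

/-- `min E` (with the irrelevant value `1` for the empty set). -/
def minElt (E : Finset ℕ+) : ℕ+ := if h : E.Nonempty then E.min' h else 1

/-- The members of the family `𝓕` that are maximal for the initial segment ordering. -/
def MAX (𝓕 : Set (Finset ℕ+)) : Set (Finset ℕ+) :=
  {E | E ∈ 𝓕 ∧ ∀ F ∈ 𝓕, InitSeg E F → F = E}

/-- `𝓕[𝓖]`: the empty set and all unions `E₁ ∪ ⋯ ∪ Eₘ` with `E₁ < ⋯ < Eₘ` non-empty members of `𝓖`
and `{min E₁, …, min Eₘ} ∈ 𝓕`. -/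
def convolution (𝓕 𝓖 : Set (Finset ℕ+)) : Set (Finset ℕ+) :=
  {E | E = ∅ ∨ ∃ (m : ℕ) (F : Fin m → Finset ℕ+),
    (∀ i, (F i).Nonempty ∧ F i ∈ 𝓖) ∧ (∀ i j, i < j → Before (F i) (F j)) ∧
    Finset.univ.image (fun i => minElt (F i)) ∈ 𝓕 ∧ E = Finset.univ.biUnion F}

/-! ## Schreier families -/

/-- A choice, for every countable limit ordinal `ξ`, of a sequence `ξ₁ < ξ₂ < ⋯` with
supremum `ξ`.  (The values at the other ordinals play no role.) -/
structure FundamentalSequences where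
  seq : Ordinal.{0} → ℕ+ → Ordinal.{0}
  seq_lt : ∀ ξ, Order.IsSuccLimit ξ → ∀ n, seq ξ n < ξ
  strictMono : ∀ ξ, Order.IsSuccLimit ξ → ξ < ω₁ → StrictMono (seq ξ)
  isLUB : ∀ ξ, Order.IsSuccLimit ξ → ξ < ω₁ → IsLUB (Set.range (seq ξ)) ξ

/-- The Schreier families `𝓢_ξ` built from the chosen sequences. -/
def schreier (c : FundamentalSequences) (ξ : Ordinal.{0}) : Set (Finset ℕ+) :=
  Ordinal.limitRecOn (motive := fun _ => Set (Finset ℕ+)) ξ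
    {E | E = ∅ ∨ ∃ n, E = {n}}
    (fun _ S => {E | E = ∅ ∨ ∃ (m : ℕ) (F : Fin m → Finset ℕ+),
      (∀ i, (F i).Nonempty ∧ F i ∈ S) ∧ (∀ i j, i < j → Before (F i) (F j)) ∧
      (∀ k ∈ E, m ≤ (k : ℕ)) ∧ E = Finset.univ.biUnion F})
    (fun o ho S => {E | E = ∅ ∨ ∃ n : ℕ+, (∀ k ∈ E, n ≤ k) ∧
      E ∈ S (c.seq o n + 1) (ho.add_one_lt (c.seq_lt o ho n))})

/-- The standing requirement on the characteristic sequences: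
`𝓢_{ξₙ + 1} ⊆ 𝓢_{ξₙ₊₁}` for all `n` and all countable limit ordinals `ξ`. -/
def FundamentalSequences.IsNested (c : FundamentalSequences) : Prop :=
  ∀ ξ, Order.IsSuccLimit ξ → ξ < ω₁ → ∀ n : ℕ+,
    schreier c (c.seq ξ n + 1) ⊆ schreier c (c.seq ξ (n + 1))

/-! ## Decompositions into successive maximal members of a family -/

/-- `F 0 < F 1 < ⋯` are successive maximal members of `𝓕` with union `M`. -/
def IsDecomposition (𝓕 : Set (Finset ℕ+)) (M : Set ℕ+) (F : ℕ → Finset ℕ+) : Prop :=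
  (∀ k, F k ∈ MAX 𝓕) ∧ (∀ i j, i < j → Before (F i) (F j)) ∧ (⋃ k, (F k : Set ℕ+)) = M

/-- The `𝓕`-decomposition of the infinite set `M`: the unique sequence of successive maximal members
of `𝓕` with union `M`. -/
def decomposition (𝓕 : Set (Finset ℕ+)) (M : Set ℕ+) : ℕ → Finset ℕ+ :=
  Classical.epsilon (IsDecomposition 𝓕 M)

/-- The union of the first `n` sets of the `𝓕`-decomposition of `M`. -/
def cut (𝓕 : Set (Finset ℕ+)) (M : Set ℕ+) (n : ℕ) : Finset ℕ+ :=
  (Finset.range n).biUnion (decomposition 𝓕 M)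

/-- `E = F₁ ∪ ⋯ ∪ Fₘ ∪ G` with `F₁ < ⋯ < Fₘ < G`, `Fᵢ ∈ MAX 𝓕` and `∅ ≠ G ∈ 𝓕`. -/
def IsLastPiece (𝓕 : Set (Finset ℕ+)) (E G : Finset ℕ+) : Prop :=
  ∃ (m : ℕ) (F : Fin m → Finset ℕ+),
    (∀ i, F i ∈ MAX 𝓕) ∧ (∀ i j, i < j → Before (F i) (F j)) ∧ (∀ i, Before (F i) G) ∧
    G ∈ 𝓕 ∧ G.Nonempty ∧ E = Finset.univ.biUnion F ∪ G

/-- The last set of the unique decomposition of the non-empty finite set `E` into successive members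
of `𝓕`, all of them except possibly the last being maximal. -/
def lastPiece (𝓕 : Set (Finset ℕ+)) (E : Finset ℕ+) : Finset ℕ+ :=
  Classical.epsilon (IsLastPiece 𝓕 E)

/-! ## Weights -/

/-- The weights `p^ξ_E` of the repeated averages hierarchy. -/
def pWeight (c : FundamentalSequences) (ξ : Ordinal.{0}) : Finset ℕ+ → ℝ :=
  Ordinal.limitRecOn (motive := fun _ => Finset ℕ+ → ℝ) ξ
    (fun _ => 1)
    (fun o p E =>
      let G := lastPiece (schreier c (o + 1)) E
      p (lastPiece (schreier c o) G) / ((minElt G : ℕ) : ℝ))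
    (fun o ho p E =>
      let G := lastPiece (schreier c o) E
      p (c.seq o (minElt G) + 1) (ho.add_one_lt (c.seq_lt o ho _)) G)

/-- The weights `q^{ξ,ζ}_E`, by recursion on `ζ`. -/
def qWeight (c : FundamentalSequences) (ξ ζ : Ordinal.{0}) : Finset ℕ+ → ℝ :=
  Ordinal.limitRecOn (motive := fun _ => Finset ℕ+ → ℝ) ζ
    (fun _ => 1)
    (fun o q E =>
      let G := lastPiece (convolution (schreier c (o + 1)) (schreier c ξ)) E
      q (lastPiece (convolution (schreier c o) (schreier c ξ)) G) / √((minElt G : ℕ) : ℝ))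
    (fun o ho q E =>
      let G := lastPiece (convolution (schreier c o) (schreier c ξ)) E
      q (c.seq o (minElt G) + 1) (ho.add_one_lt (c.seq_lt o ho _)) G)

/-! ## Blocked sums along branches -/

section Banach

universe u

variable {𝕜 : Type*} [RCLike 𝕜]
variable {U : Type*} [NormedAddCommGroup U] [NormedSpace 𝕜 U]
variable {V : Type*} [NormedAddCommGroup V] [NormedSpace 𝕜 V]

variable (𝕜) in
open Classical in
/-- `∑ w_E u_E` over all `E` with `N|ₙ ≺ E ≼ N|ₙ₊₁`, where `N|ₙ` is the union of the first `n` sets of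
the `𝓕`-decomposition of `N`.  (The index `n` starts at `0`.) -/
def blockSum (𝓕 : Set (Finset ℕ+)) (w : Finset ℕ+ → ℝ) (N : Set ℕ+) (u : Finset ℕ+ → U)
    (n : ℕ) : U :=
  ∑ E ∈ (cut 𝓕 N (n + 1)).powerset with
      ProperInitSeg (cut 𝓕 N n) E ∧ InitSeg E (cut 𝓕 N (n + 1)),
    (w E : 𝕜) • u E

variable (𝕜) in
/-- The sequence `𝔼_{ξ,N} 𝔲`. -/
def avg (c : FundamentalSequences) (ξ : Ordinal.{0}) (N : Set ℕ+) (u : Finset ℕ+ → U) : ℕ → U :=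
  blockSum 𝕜 (schreier c ξ) (pWeight c ξ) N u

variable (𝕜) in
/-- The sequence `𝔼⁽²⁾_{ξ,ζ,N} 𝔲`. -/
def avg₂ (c : FundamentalSequences) (ξ ζ : Ordinal.{0}) (N : Set ℕ+) (u : Finset ℕ+ → U) : ℕ → U :=
  blockSum 𝕜 (convolution (schreier c ζ) (schreier c ξ))
    (fun E => qWeight c ξ ζ E * pWeight c ξ E) N u

variable (𝕜) in
/-- The weakly `p`-summing norm `‖(eᵢ)‖ₚʷ ∈ [0, ∞]`. -/
def weakNorm (p : ℝ) (e : ℕ → V) : ℝ≥0∞ :=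
  ⨆ f : V →L[𝕜] 𝕜, ⨆ _ : ‖f‖ ≤ 1, (∑' i, ‖f (e i)‖ₑ ^ p) ^ (1 / p)

variable (𝕜) in
/-- The collection `(u_E)`, `E` a non-empty finite set of positive integers, is weakly null:
for every finite `F` the sequence `(u_{F ∪ {k}})_{k > max F}` is weakly null.
(The value of `u` at `∅` plays no role.) -/
def WeaklyNull (u : Finset ℕ+ → U) : Prop :=
  ∀ F : Finset ℕ+, ∀ f : U →L[𝕜] 𝕜, Tendsto (fun k : ℕ+ => f (u (insert k F))) atTop (𝓝 0)

/-- The `γ`-`S_ξ` Property of an operator. -/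
def HasS (c : FundamentalSequences) (ξ : Ordinal.{0}) (γ : ℝ≥0) (A : U →L[𝕜] V) : Prop :=
  ∀ u : Finset ℕ+ → U, (∀ E, E.Nonempty → ‖u E‖ ≤ 1) → WeaklyNull 𝕜 u →
    ∀ L : Set ℕ+, L.Infinite → ∃ M ⊆ L, M.Infinite ∧
      weakNorm 𝕜 2 (fun n => A (avg 𝕜 c ξ M u n)) ≤ γ

/-- The `γ`-`G_{ξ,ζ}` Property of an operator. -/
def HasG (c : FundamentalSequences) (ξ ζ : Ordinal.{0}) (γ : ℝ≥0) (A : U →L[𝕜] V) : Prop :=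
  ∀ u : Finset ℕ+ → U, (∀ E, E.Nonempty → ‖u E‖ ≤ 1) → WeaklyNull 𝕜 u →
    ∀ L : Set ℕ+, L.Infinite → ∃ M ⊆ L, M.Infinite ∧
      weakNorm 𝕜 1 (fun n => A (avg₂ 𝕜 c ξ ζ M u n)) ≤ γ

/-- `𝔰_ξ(A) ∈ [0, ∞]`. -/
def sNorm (c : FundamentalSequences) (ξ : Ordinal.{0}) (A : U →L[𝕜] V) : ℝ≥0∞ :=
  ⨅ γ : ℝ≥0, ⨅ _ : HasS c ξ γ A, (γ : ℝ≥0∞)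

/-- `𝔤_{ξ,ζ}(A) ∈ [0, ∞]`. -/
def gNorm (c : FundamentalSequences) (ξ ζ : Ordinal.{0}) (A : U →L[𝕜] V) : ℝ≥0∞ :=
  ⨅ γ : ℝ≥0, ⨅ _ : HasG c ξ ζ γ A, (γ : ℝ≥0∞)

variable (𝕜) in
/-- `𝔖_ξ(U, V)`: the operators with the `S_ξ` Property. -/
def classS (c : FundamentalSequences) (ξ : Ordinal.{0}) (U V : Type*)
    [NormedAddCommGroup U] [NormedSpace 𝕜 U] [NormedAddCommGroup V] [NormedSpace 𝕜 V] :
    Set (U →L[𝕜] V) :=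
  {A | ∃ γ : ℝ≥0, HasS c ξ γ A}

variable (𝕜) in
/-- `𝔊_{ξ,ζ}(U, V)`: the operators with the `G_{ξ,ζ}` Property. -/
def classG (c : FundamentalSequences) (ξ ζ : Ordinal.{0}) (U V : Type*)
    [NormedAddCommGroup U] [NormedSpace 𝕜 U] [NormedAddCommGroup V] [NormedSpace 𝕜 V] :
    Set (U →L[𝕜] V) :=
  {A | ∃ γ : ℝ≥0, HasG c ξ ζ γ A}

variable (𝕜) in
/-- The Banach space `U` has the `S_ξ` Property. -/
def SpaceHasS (c : FundamentalSequences) (ξ : Ordinal.{0}) (U : Type*)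
    [NormedAddCommGroup U] [NormedSpace 𝕜 U] : Prop :=
  ContinuousLinearMap.id 𝕜 U ∈ classS 𝕜 c ξ U U

variable (𝕜) in
/-- The Banach space `U` has the `G_{ξ,ζ}` Property. -/
def SpaceHasG (c : FundamentalSequences) (ξ ζ : Ordinal.{0}) (U : Type*)
    [NormedAddCommGroup U] [NormedSpace 𝕜 U] : Prop :=
  ContinuousLinearMap.id 𝕜 U ∈ classG 𝕜 c ξ ζ U U

/-! ## Operator ideals and embeddings -/

variable (𝕜) in
/-- A class of operators between Banach spaces over `𝕜`. -/
abbrev OperatorClass : Type _ :=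
  ∀ (U V : Type u) [NormedAddCommGroup U] [NormedSpace 𝕜 U] [CompleteSpace U]
    [NormedAddCommGroup V] [NormedSpace 𝕜 V] [CompleteSpace V], Set (U →L[𝕜] V)

/-- An operator ideal: every component is a linear space containing the finite rank operators, and
`A B C` belongs to the class whenever `B` does. -/
structure IsOperatorIdeal (𝔄 : OperatorClass.{u} 𝕜) : Prop where
  finiteRank_mem : ∀ (U V : Type u) [NormedAddCommGroup U] [NormedSpace 𝕜 U] [CompleteSpace U]
    [NormedAddCommGroup V] [NormedSpace 𝕜 V] [CompleteSpace V] (A : U →L[𝕜] V),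
    FiniteDimensional 𝕜 (LinearMap.range (A : U →ₗ[𝕜] V)) → A ∈ 𝔄 U V
  add_mem : ∀ (U V : Type u) [NormedAddCommGroup U] [NormedSpace 𝕜 U] [CompleteSpace U]
    [NormedAddCommGroup V] [NormedSpace 𝕜 V] [CompleteSpace V] (A B : U →L[𝕜] V),
    A ∈ 𝔄 U V → B ∈ 𝔄 U V → A + B ∈ 𝔄 U V
  smul_mem : ∀ (U V : Type u) [NormedAddCommGroup U] [NormedSpace 𝕜 U] [CompleteSpace U]
    [NormedAddCommGroup V] [NormedSpace 𝕜 V] [CompleteSpace V] (a : 𝕜) (A : U →L[𝕜] V),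
    A ∈ 𝔄 U V → a • A ∈ 𝔄 U V
  comp_mem : ∀ (T U V W : Type u) [NormedAddCommGroup T] [NormedSpace 𝕜 T] [CompleteSpace T]
    [NormedAddCommGroup U] [NormedSpace 𝕜 U] [CompleteSpace U]
    [NormedAddCommGroup V] [NormedSpace 𝕜 V] [CompleteSpace V]
    [NormedAddCommGroup W] [NormedSpace 𝕜 W] [CompleteSpace W]
    (A : V →L[𝕜] W) (B : U →L[𝕜] V) (C : T →L[𝕜] U),
    B ∈ 𝔄 U V → (A.comp B).comp C ∈ 𝔄 T W

/-- `j` is an isomorphic embedding (an isomorphism onto its range). -/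
def IsIsomorphicEmbedding (j : U →L[𝕜] V) : Prop :=
  ∃ δ : ℝ, 0 < δ ∧ ∀ x, δ * ‖x‖ ≤ ‖j x‖

variable (𝕜) in
/-- `X` contains an isomorphic copy of `ℓ₁`. -/
def ContainsEllOne (X : Type*) [NormedAddCommGroup X] [NormedSpace 𝕜 X] : Prop :=
  ∃ j : lp (fun _ : ℕ => 𝕜) 1 →L[𝕜] X, IsIsomorphicEmbedding j

end Banach

end RepeatedAverages

end

open RepeatedAverages

universe u v w

noncomputable section

namespace RepeatedAverages

/-! ## Successive unions -/

/-! Both properties are instances of one property `HasBlock`, given by a family `𝓕`, weights `w` and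
an exponent `p`. The argument uses only that `𝓕` is regular, `|w E| ≤ 1` and `p ≥ 1`. Regularity of
`𝓢_ζ[𝓢_ξ]` is proved by induction on `ζ`, because convolution on the left commutes with the
successor and the limit step of the Schreier recursion.

Regularity makes the decompositions exist, and the first `n` pieces of `M` depend only on a finite
initial part of `M`. Hence failure of the norm bound along `N` is an open condition on `N`. By
Ramsey's theorem for open sets the bound may be assumed for all infinite subsets of some `M`
(`HasBlock.exists_forall`), and the triangle inequality follows by choosing for `B` inside a set
that is already good for `A`.

For a compact `A`, fusion gives an `M` with `‖A u_E‖ ≤ 2^(-|E|)` for all non-empty `E ⊆ M`. Initial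
segments of `M` have distinct sizes, so the norms of all blocks add up to at most `1`. Embeddings
are handled by extending functionals with Hahn–Banach.

For a surjection `Q` from a space without `ℓ₁`, lift each `u_E` boundedly, make every sequence of
lifts weakly Cauchy along one `M` by Rosenthal's theorem and diagonalization, then subtract convex
combinations with small image (Mazur). The result is a weakly null lift that is exact on subsets of
`M`. A subspace of a quotient is a quotient of a subspace, so the last assertion combines the two
transfer results. -/

/-- `E` is a union of `m` successive non-empty members of `𝓖`, with set of minima `D`. -/
inductive Blocks (𝓖 : Set (Finset ℕ+)) : ℕ → Finset ℕ+ → Finset ℕ+ → Prop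
  | empty : Blocks 𝓖 0 ∅ ∅
  | append {m : ℕ} {D E G : Finset ℕ+} : Blocks 𝓖 m D E → G ∈ 𝓖 → G.Nonempty → Before E G →
      Blocks 𝓖 (m + 1) (insert (minElt G) D) (E ∪ G)

theorem minElt_mem {E : Finset ℕ+} (h : E.Nonempty) : minElt E ∈ E := by
  rw [minElt, dif_pos h]
  exact E.min'_mem h

theorem minElt_le {E : Finset ℕ+} {k : ℕ+} (h : k ∈ E) : minElt E ≤ k := by
  rw [minElt, dif_pos ⟨k, h⟩]
  exact E.min'_le k h

theorem minElt_eq {E : Finset ℕ+} {k : ℕ+} (h : k ∈ E) (h' : ∀ a ∈ E, k ≤ a) : minElt E = k :=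
  le_antisymm (minElt_le h) (h' _ (minElt_mem ⟨k, h⟩))

/-- Bridge between the `Fin m`-indexed unions of the definitions and the inductive form, in which
the last block can be peeled off. -/
theorem blocks_iff {𝓖 : Set (Finset ℕ+)} {m : ℕ} {D E : Finset ℕ+} :
    Blocks 𝓖 m D E ↔ ∃ F : Fin m → Finset ℕ+,
      (∀ i, (F i).Nonempty ∧ F i ∈ 𝓖) ∧ (∀ i j, i < j → Before (F i) (F j)) ∧
      Finset.univ.image (fun i => minElt (F i)) = D ∧ E = Finset.univ.biUnion F := by
  constructor
  · intro h
    induction h with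
    | empty => exact ⟨fun i => i.elim0, fun i => i.elim0, fun i => i.elim0, by simp, by simp⟩
    | @append m D E G h hG hne hb ih =>
      obtain ⟨F, h1, h2, rfl, rfl⟩ := ih
      refine ⟨Fin.snoc F G, ?_, ?_, ?_, ?_⟩
      · intro i
        refine Fin.lastCases ?_ (fun i => ?_) i
        · simpa using ⟨hne, hG⟩
        · simpa using h1 i
      · intro i j
        refine Fin.lastCases ?_ (fun j => ?_) j
        · refine Fin.lastCases (fun h => absurd h (lt_irrefl _)) (fun i _ => ?_) i
          simp only [Fin.snoc_castSucc, Fin.snoc_last]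
          exact fun a ha b hb' => hb a (Finset.mem_biUnion.2 ⟨i, Finset.mem_univ _, ha⟩) b hb'
        · refine Fin.lastCases (fun h => ?_) (fun i h => ?_) i
          · exact absurd h (Fin.le_last _).not_gt
          · simpa using h2 i j (by simpa using h)
      · ext a
        simp [Fin.exists_fin_succ', eq_comm, or_comm]
      · ext a
        simp [Fin.exists_fin_succ']
  · rintro ⟨F, h1, h2, rfl, rfl⟩
    induction m with
    | zero => simpa using Blocks.empty
    | succ m ih =>
      have key := Blocks.append (ih (fun i => F i.castSucc) (fun i => h1 _)
        (fun i j hij => h2 _ _ (by simpa using hij))) (h1 (Fin.last m)).2 (h1 (Fin.last m)).1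
        (by
          intro a ha b hb
          obtain ⟨i, -, hi⟩ := Finset.mem_biUnion.1 ha
          exact h2 _ _ (Fin.castSucc_lt_last i) a hi b hb)
      convert key using 1
      · ext a
        simp [Fin.exists_fin_succ', eq_comm, or_comm]
      · ext a
        simp [Fin.exists_fin_succ']

namespace Blocks

variable {𝓖 : Set (Finset ℕ+)} {m n : ℕ} {D D' E E' : Finset ℕ+}

theorem subset (h : Blocks 𝓖 m D E) : D ⊆ E := by
  induction h with
  | empty => simp
  | append h hG hne hb ih =>
    intro a ha
    rcases Finset.mem_insert.1 ha with rfl | ha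
    · exact Finset.mem_union_right _ (minElt_mem hne)
    · exact Finset.mem_union_left _ (ih ha)

theorem exists_le (h : Blocks 𝓖 m D E) : ∀ e ∈ E, ∃ d ∈ D, d ≤ e := by
  induction h with
  | empty => simp
  | append h hG hne hb ih =>
    intro e he
    rcases Finset.mem_union.1 he with he | he
    · obtain ⟨d, hd, hde⟩ := ih e he
      exact ⟨d, Finset.mem_insert_of_mem hd, hde⟩
    · exact ⟨_, Finset.mem_insert_self _ _, minElt_le he⟩

/-- Every element of `E` dominates the minimum of its block. This transfers conditions such as `m ≤
min` between `E` and `D`; the constant predicate `False` compares emptiness. -/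
theorem forall_le_iff (h : Blocks 𝓖 m D E) {p : ℕ+ → Prop}
    (hp : ∀ a b, a ≤ b → p a → p b) : (∀ k ∈ D, p k) ↔ ∀ k ∈ E, p k := by
  refine ⟨fun H k hk => ?_, fun H k hk => H k (h.subset hk)⟩
  obtain ⟨d, hd, hdk⟩ := h.exists_le k hk
  exact hp _ _ hdk (H d hd)

theorem eq_empty_iff (h : Blocks 𝓖 m D E) : D = ∅ ↔ E = ∅ := by
  simp only [Finset.eq_empty_iff_forall_notMem]
  exact h.forall_le_iff (p := fun _ => False) fun _ _ _ h => h

theorem minElt_eq (h : Blocks 𝓖 m D E) (hE : E.Nonempty) : minElt D = minElt E := by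
  have hD : D.Nonempty := by
    rw [Finset.nonempty_iff_ne_empty] at hE ⊢
    rwa [Ne, h.eq_empty_iff]
  refine RepeatedAverages.minElt_eq ?_ ?_
  · obtain ⟨d, hd, hle⟩ := h.exists_le _ (minElt_mem hE)
    rwa [← le_antisymm hle (minElt_le (h.subset hd))]
  · exact fun a ha => minElt_le (h.subset ha)

theorem single {G : Finset ℕ+} (hG : G ∈ 𝓖) (hne : G.Nonempty) : Blocks 𝓖 1 {minElt G} G := by
  have := Blocks.append (𝓖 := 𝓖) Blocks.empty hG hne (by simp [Before])
  simpa using this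

theorem concat (h : Blocks 𝓖 m D E) (h' : Blocks 𝓖 n D' E') (hb : Before E E') :
    Blocks 𝓖 (m + n) (D ∪ D') (E ∪ E') := by
  induction h' with
  | empty => simpa using h
  | append h' hG hne hb' ih =>
    have := (ih fun a ha b hb'' => hb a ha b (Finset.mem_union_left _ hb'')).append hG hne (by
      intro a ha b hb''
      rcases Finset.mem_union.1 ha with ha | ha
      · exact hb a ha b (Finset.mem_union_right _ hb'')
      · exact hb' a ha b hb'')
    rwa [← Finset.union_insert, Finset.union_assoc] at this

/-- Intersect each block with the subset and drop the empty traces: the number of blocks can only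
decrease. -/
theorem hereditary (h𝓖 : ∀ G ∈ 𝓖, ∀ G' ⊆ G, G' ∈ 𝓖) (h : Blocks 𝓖 m D E) :
    ∀ E' ⊆ E, ∃ n ≤ m, ∃ D', Blocks 𝓖 n D' E' := by
  induction h with
  | empty =>
    intro E' hE'
    obtain rfl := Finset.subset_empty.1 hE'
    exact ⟨0, le_rfl, ∅, .empty⟩
  | @append m D E G h hG hne hb ih =>
    intro E' hE'
    obtain ⟨n, hn, D', h'⟩ := ih (E' ∩ E) Finset.inter_subset_right
    have hE : E' = (E' ∩ E) ∪ (E' ∩ G) := by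
      rw [← Finset.inter_union_distrib_left]
      exact (Finset.inter_eq_left.2 hE').symm
    rcases (E' ∩ G).eq_empty_or_nonempty with h0 | h0
    · rw [hE, h0, Finset.union_empty]
      exact ⟨n, by omega, D', h'⟩
    · rw [hE]
      exact ⟨n + 1, by omega, _, h'.append (h𝓖 G hG _ Finset.inter_subset_right) h0
        fun a ha b hb' => hb a (Finset.mem_inter.1 ha).2 b (Finset.mem_inter.1 hb').2⟩

/-- Splitting along a splitting of the set of minima. -/
theorem split (h : Blocks 𝓖 m D E) : ∀ D₁ D₂, D = D₁ ∪ D₂ → Before D₁ D₂ →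
    ∃ m₁ m₂ E₁ E₂, Blocks 𝓖 m₁ D₁ E₁ ∧ Blocks 𝓖 m₂ D₂ E₂ ∧ E = E₁ ∪ E₂ ∧ Before E₁ E₂ := by
  induction h with
  | empty =>
    intro D₁ D₂ hD _
    obtain ⟨rfl, rfl⟩ := Finset.union_eq_empty.1 hD.symm
    exact ⟨0, 0, ∅, ∅, .empty, .empty, by simp, by simp [Before]⟩
  | @append m D E G h hG hne hb ih =>
    intro D₁ D₂ hD h12
    have hlt : ∀ d ∈ D, d < minElt G := fun d hd => hb d (h.subset hd) _ (minElt_mem hne)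
    have hnot : minElt G ∉ D := fun hd => lt_irrefl _ (hlt _ hd)
    -- `minElt G` is the largest minimum. Either it lies in `D₂`, and `G` joins the second part, or
    -- it lies in `D₁`, which forces `D₂ = ∅`.
    by_cases h2 : minElt G ∈ D₂
    · have h1 : minElt G ∉ D₁ := fun h1 => lt_irrefl _ (h12 _ h1 _ h2)
      obtain ⟨m₁, m₂, E₁, E₂, hE₁, hE₂, rfl, hb12⟩ := ih D₁ (D₂.erase (minElt G)) (by
          rw [← Finset.erase_insert hnot, hD, Finset.erase_union_distrib,
            Finset.erase_eq_of_notMem h1])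
        fun a ha b hb => h12 a ha b (Finset.mem_of_mem_erase hb)
      refine ⟨m₁, m₂ + 1, E₁, E₂ ∪ G, hE₁, ?_, Finset.union_assoc _ _ _, ?_⟩
      · have := hE₂.append hG hne fun a ha b hb' => hb a (Finset.mem_union_right _ ha) b hb'
        rwa [Finset.insert_erase h2] at this
      · intro a ha b hb'
        rcases Finset.mem_union.1 hb' with hb' | hb'
        · exact hb12 a ha b hb'
        · exact hb a (Finset.mem_union_left _ ha) b hb'
    · have h1 : minElt G ∈ D₁ := by
        have := Finset.mem_insert_self (minElt G) D
        rw [hD] at this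
        exact (Finset.mem_union.1 this).resolve_right h2
      have hD₂ : D₂ = ∅ := by
        refine Finset.eq_empty_of_forall_notMem fun d hd => ?_
        have h3 := h12 _ h1 d hd
        have : d ∈ insert (minElt G) D := hD ▸ Finset.mem_union_right _ hd
        rcases Finset.mem_insert.1 this with rfl | h4
        · exact lt_irrefl _ h3
        · exact lt_asymm h3 (hlt d h4)
      subst hD₂
      rw [Finset.union_empty] at hD
      subst hD
      exact ⟨m + 1, 0, E ∪ G, ∅, h.append hG hne hb, .empty, by simp, by simp [Before]⟩

end Blocks

/-! ## Regular families -/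

/-- The properties of the Schreier families that guarantee the decompositions. -/
structure Regular (𝓕 : Set (Finset ℕ+)) : Prop where
  empty_mem : ∅ ∈ 𝓕
  singleton_mem : ∀ n, {n} ∈ 𝓕
  hereditary : ∀ G ∈ 𝓕, ∀ G' ⊆ G, G' ∈ 𝓕
  -- Whether `E` can be extended by a later point does not depend on the point, so maximality can be
  -- tested on the next element of any given set.
  exchange : ∀ E k n, (∀ e ∈ E, e < k) → (∀ e ∈ E, e < n) → insert k E ∈ 𝓕 → insert n E ∈ 𝓕
  exists_notMem : ∀ M : Set ℕ+, M.Infinite → ∃ E : Finset ℕ+, ↑E ⊆ M ∧ E ∉ 𝓕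

/-- The unions of at most `min E` successive members of `𝓖`. -/
def succFamily (𝓖 : Set (Finset ℕ+)) : Set (Finset ℕ+) :=
  {E | ∃ m D, Blocks 𝓖 m D E ∧ ∀ k ∈ E, m ≤ (k : ℕ)}

/-- The diagonal union of a sequence of families. -/
def diagFamily (𝓖 : ℕ+ → Set (Finset ℕ+)) : Set (Finset ℕ+) :=
  {E | E = ∅ ∨ ∃ n : ℕ+, (∀ k ∈ E, n ≤ k) ∧ E ∈ 𝓖 n}

theorem exists_mem_gt {M : Set ℕ+} (hM : M.Infinite) (k : ℕ+) : ∃ n ∈ M, k < n := by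
  by_contra! h
  exact hM ((Set.finite_Iic k).subset h)

theorem infinite_inter_above {M : Set ℕ+} (hM : M.Infinite) (s : Finset ℕ+) :
    {n ∈ M | ∀ k ∈ s, k < n}.Infinite := by
  intro h
  refine hM ((h.union (s.finite_toSet.biUnion fun k _ => Set.finite_Iic k)).subset fun n hn => ?_)
  by_cases hs : ∀ k ∈ s, k < n
  · exact .inl ⟨hn, hs⟩
  · push Not at hs
    obtain ⟨k, hk, hkn⟩ := hs
    exact .inr (Set.mem_biUnion (Finset.mem_coe.2 hk) hkn)

namespace Regular

variable {𝓖 : Set (Finset ℕ+)}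

theorem schreier_zero : Regular {E : Finset ℕ+ | E = ∅ ∨ ∃ n, E = {n}} where
  empty_mem := .inl rfl
  singleton_mem n := .inr ⟨n, rfl⟩
  hereditary := by
    rintro G (rfl | ⟨n, rfl⟩) G' hG'
    · exact .inl (Finset.subset_empty.1 hG')
    · rcases Finset.subset_singleton_iff.1 hG' with h | h
      · exact .inl h
      · exact .inr ⟨n, h⟩
  exchange := by
    intro E k n hk hn h
    have : E = ∅ := by
      refine Finset.eq_empty_of_forall_notMem fun e he => ?_
      rcases h with h | ⟨j, h⟩
      · simp at h
      · have h1 : k = j := Finset.mem_singleton.1 (h ▸ Finset.mem_insert_self _ _)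
        have h2 : e = j := Finset.mem_singleton.1 (h ▸ Finset.mem_insert_of_mem he)
        exact (hk e he).ne (h2.trans h1.symm)
    subst this
    exact .inr ⟨n, by simp⟩
  exists_notMem := by
    intro M hM
    obtain ⟨a, ha⟩ := hM.nonempty
    obtain ⟨b, hb, hab⟩ := exists_mem_gt hM a
    refine ⟨{a, b}, by simp [Set.insert_subset_iff, ha, hb], ?_⟩
    rintro (h | ⟨n, h⟩)
    · simp at h
    · have h1 : a = n := Finset.mem_singleton.1 (h ▸ by simp)
      have h2 : b = n := Finset.mem_singleton.1 (h ▸ by simp)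
      exact hab.ne (h1.trans h2.symm)

theorem succ (h : Regular 𝓖) : Regular (succFamily 𝓖) where
  empty_mem := ⟨0, ∅, .empty, by simp⟩
  singleton_mem n := ⟨1, _, .single (h.singleton_mem n) (by simp), fun k _ => k.pos⟩
  hereditary := by
    rintro G ⟨m, D, hD, hm⟩ G' hG'
    obtain ⟨n, hn, D', hD'⟩ := hD.hereditary h.hereditary G' hG'
    exact ⟨n, D', hD', fun k hk => hn.trans (hm k (hG' hk))⟩
  exchange := by
    rintro E k n hk hn ⟨m, D, hD, hm⟩
    -- For non-empty `E` the replaced point is not the minimum, so the bound on the number of blocks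
    -- survives. The empty case needs the singletons.
    rcases E.eq_empty_or_nonempty with rfl | ⟨e, he⟩
    · exact ⟨1, _, .single (h.singleton_mem n) (by simp), fun k _ => k.pos⟩
    have hm' : ∀ j ∈ insert n E, m ≤ (j : ℕ) := by
      intro j hj
      rcases Finset.mem_insert.1 hj with rfl | hj
      · exact (hm e (Finset.mem_insert_of_mem he)).trans (hn e he).le
      · exact hm j (Finset.mem_insert_of_mem hj)
    suffices H : ∀ E', insert k E = E' → Blocks 𝓖 m D E' → ∃ D', Blocks 𝓖 m D' (insert n E) by
      obtain ⟨D', h'⟩ := H _ rfl hD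
      exact ⟨m, D', h', hm'⟩
    intro E' hE' hB
    cases hB with
    | empty => simp at hE'
    | @append m D E₀ G hB hG hne hb =>
      have hkG : k ∈ G := by
        have : k ∈ E₀ ∪ G := hE' ▸ Finset.mem_insert_self _ _
        refine (Finset.mem_union.1 this).resolve_left fun hk0 => ?_
        obtain ⟨g, hg⟩ := hne
        have h1 := hb k hk0 g hg
        have : g ∈ insert k E := hE' ▸ Finset.mem_union_right _ hg
        rcases Finset.mem_insert.1 this with rfl | h2
        · exact lt_irrefl _ h1
        · exact lt_asymm h1 (hk g h2)
      have hk0 : k ∉ E₀ := fun h0 => lt_irrefl _ (hb k h0 k hkG)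
      have hkE : k ∉ E := fun h0 => lt_irrefl _ (hk k h0)
      have hE : E = E₀ ∪ G.erase k := by
        rw [← Finset.erase_insert hkE, hE', Finset.erase_union_distrib,
          Finset.erase_eq_of_notMem hk0]
      have hG' : insert n (G.erase k) ∈ 𝓖 := by
        refine h.exchange _ k n (fun a ha => hk a ?_) (fun a ha => hn a ?_)
          (by rwa [Finset.insert_erase hkG]) <;>
        exact hE ▸ Finset.mem_union_right _ ha
      refine ⟨insert (minElt (insert n (G.erase k))) D, ?_⟩
      rw [hE, ← Finset.union_insert]
      refine hB.append hG' (by simp) fun a ha b hb' => ?_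
      rcases Finset.mem_insert.1 hb' with rfl | hb'
      · exact hn a (hE ▸ Finset.mem_union_left _ ha)
      · exact hb a ha b (Finset.mem_of_mem_erase hb')
  exists_notMem := by
    -- Enlarge a set `E` that is bad for `m` by some `H ∉ 𝓖` beyond it. With `m + 1` blocks, either
    -- `E` lies in all but the last, or the last block meets `E` and therefore contains `H`.
    have key : ∀ m : ℕ, ∀ M : Set ℕ+, M.Infinite →
        ∃ E : Finset ℕ+, ↑E ⊆ M ∧ ∀ n ≤ m, ∀ D, ¬ Blocks 𝓖 n D E := by
      intro m
      induction m with
      | zero =>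
        intro M hM
        obtain ⟨a, ha⟩ := hM.nonempty
        refine ⟨{a}, by simpa using ha, ?_⟩
        intro n hn D hB
        generalize hE : ({a} : Finset ℕ+) = E at hB
        cases hB with
        | empty => simp at hE
        | append => omega
      | succ m ih =>
        intro M hM
        obtain ⟨E, hEM, hE⟩ := ih M hM
        obtain ⟨H, hHM, hH⟩ := h.exists_notMem _ (infinite_inter_above hM E)
        refine ⟨E ∪ H, ?_, ?_⟩
        · rw [Finset.coe_union]
          exact Set.union_subset hEM fun a ha => (hHM ha).1
        intro n hn D hB
        generalize hEH : E ∪ H = E' at hB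
        cases hB with
        | empty =>
          obtain ⟨rfl, rfl⟩ := Finset.union_eq_empty.1 hEH
          exact hH h.empty_mem
        | @append n D E₀ G hB hG hne hb =>
          by_cases hsub : E ⊆ E₀
          · obtain ⟨n', hn', D', hB'⟩ := hB.hereditary h.hereditary E hsub
            exact hE n' (by omega) D' hB'
          · obtain ⟨e, he, he0⟩ := Finset.not_subset.1 hsub
            have heG : e ∈ G := (Finset.mem_union.1
              (hEH ▸ Finset.mem_union_left _ he : e ∈ E₀ ∪ G)).resolve_left he0
            refine hH (h.hereditary G hG H fun x hx => ?_)
            refine (Finset.mem_union.1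
              (hEH ▸ Finset.mem_union_right _ hx : x ∈ E₀ ∪ G)).resolve_left fun hx0 => ?_
            exact lt_asymm (hb x hx0 e heG) ((hHM hx).2 e he)
    intro M hM
    obtain ⟨a, ha⟩ := hM.nonempty
    obtain ⟨E, hEM, hE⟩ := key a M hM
    -- The element `a` caps the number of blocks at `a`, and `E` is bad for that number.
    refine ⟨insert a E, by simpa [Set.insert_subset_iff, ha] using hEM, ?_⟩
    rintro ⟨m, D, hB, hm⟩
    obtain ⟨n, hn, D', hB'⟩ := hB.hereditary h.hereditary E (Finset.subset_insert _ _)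
    exact hE n (hn.trans (hm a (Finset.mem_insert_self _ _))) D' hB'

theorem diag {𝓖 : ℕ+ → Set (Finset ℕ+)} (h : ∀ n, Regular (𝓖 n)) : Regular (diagFamily 𝓖) where
  empty_mem := .inl rfl
  singleton_mem n := .inr ⟨1, by simp, (h 1).singleton_mem n⟩
  hereditary := by
    rintro G (rfl | ⟨n, hn, hG⟩) G' hG'
    · exact .inl (Finset.subset_empty.1 hG')
    · exact .inr ⟨n, fun k hk => hn k (hG' hk), (h n).hereditary G hG G' hG'⟩
  exchange := by
    rintro E k n hk hn hE
    rcases E.eq_empty_or_nonempty with rfl | ⟨e, he⟩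
    · exact .inr ⟨1, by simp, (h 1).singleton_mem n⟩
    rcases hE with hE | ⟨j, hj, hE⟩
    · simp at hE
    refine .inr ⟨j, fun i hi => ?_, (h j).exchange E k n hk hn hE⟩
    rcases Finset.mem_insert.1 hi with rfl | hi
    · exact (hj e (Finset.mem_insert_of_mem he)).trans (hn e he).le
    · exact hj i (Finset.mem_insert_of_mem hi)
  exists_notMem := by
    intro M hM
    obtain ⟨a, ha⟩ := hM.nonempty
    choose E hEM hE using fun n => (h n).exists_notMem M hM
    -- The element `a` leaves only indices `n ≤ a`, and `E n` excludes each of them.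
    refine ⟨insert a ((Finset.Iic a).biUnion E), ?_, ?_⟩
    · intro x hx
      rcases Finset.mem_insert.1 hx with rfl | hx
      · exact ha
      · obtain ⟨n, -, hn⟩ := Finset.mem_biUnion.1 hx
        exact hEM n hn
    · rintro (h0 | ⟨n, hn, h0⟩)
      · simp at h0
      · refine hE n ((h n).hereditary _ h0 _ fun x hx => Finset.mem_insert_of_mem ?_)
        exact Finset.mem_biUnion.2 ⟨n, Finset.mem_Iic.2 (hn a (Finset.mem_insert_self _ _)), hx⟩

end Regular

/-! ## The Schreier families and their convolutions -/

theorem schreier_zero (c : FundamentalSequences) :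
    schreier c 0 = {E | E = ∅ ∨ ∃ n, E = {n}} := by
  rw [schreier, Ordinal.limitRecOn_zero]

theorem schreier_succ (c : FundamentalSequences) (o : Ordinal) :
    schreier c (o + 1) = succFamily (schreier c o) := by
  rw [schreier, Ordinal.limitRecOn_add_one]
  ext E
  simp only [Set.mem_ofPred_eq, succFamily, blocks_iff]
  constructor
  · rintro (rfl | ⟨m, F, h1, h2, h3, h4⟩)
    · exact ⟨0, ∅, ⟨fun i => i.elim0, fun i => i.elim0, fun i => i.elim0, by simp, by simp⟩,
        by simp⟩
    · exact ⟨m, _, ⟨F, h1, h2, rfl, h4⟩, h3⟩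
  · rintro ⟨m, D, ⟨F, h1, h2, -, h4⟩, h3⟩
    exact .inr ⟨m, F, h1, h2, h3, h4⟩

theorem schreier_limit (c : FundamentalSequences) {o : Ordinal} (ho : Order.IsSuccLimit o) :
    schreier c o = diagFamily fun n => schreier c (c.seq o n + 1) := by
  rw [schreier, Ordinal.limitRecOn_limit _ _ _ _ ho]
  rfl

theorem mem_convolution_iff {𝓕 𝓖 : Set (Finset ℕ+)} {E : Finset ℕ+} :
    E ∈ convolution 𝓕 𝓖 ↔ E = ∅ ∨ ∃ m D, Blocks 𝓖 m D E ∧ D ∈ 𝓕 := by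
  simp only [convolution, Set.mem_ofPred_eq, blocks_iff]
  refine or_congr_right ⟨?_, ?_⟩
  · rintro ⟨m, F, h1, h2, h3, h4⟩
    exact ⟨m, _, ⟨F, h1, h2, rfl, h4⟩, h3⟩
  · rintro ⟨m, D, ⟨F, h1, h2, rfl, h4⟩, h3⟩
    exact ⟨m, F, h1, h2, h3, h4⟩

theorem convolution_singletons {𝓖 : Set (Finset ℕ+)} (h : ∅ ∈ 𝓖) :
    convolution {E | E = ∅ ∨ ∃ n, E = {n}} 𝓖 = 𝓖 := by
  ext E
  rw [mem_convolution_iff]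
  constructor
  · rintro (rfl | ⟨m, D, hB, hD⟩)
    · exact h
    have hcard : D.card ≤ 1 := by
      rcases hD with rfl | ⟨n, rfl⟩ <;> simp
    cases hB with
    | empty => exact h
    | @append m D E G hB hG hne hb =>
      have hnot : minElt G ∉ D := fun hd => lt_irrefl _ (hb _ (hB.subset hd) _ (minElt_mem hne))
      rw [Finset.card_insert_of_notMem hnot] at hcard
      have hE : E = ∅ := hB.eq_empty_iff.1 (Finset.card_eq_zero.1 (by omega))
      rwa [hE, Finset.empty_union]
  · intro hE
    rcases E.eq_empty_or_nonempty with h0 | h0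
    · exact .inl h0
    · exact .inr ⟨1, _, .single hE h0, .inr ⟨_, rfl⟩⟩

/-- Together with `Blocks.to_convolution` this is an associativity law. A non-empty block has the
same minimum as its set of inner minima, so the outer minima `D` do not change when inner blocks are
concatenated or regrouped. -/
theorem Blocks.of_convolution {𝓕 𝓖 : Set (Finset ℕ+)} {m : ℕ} {D E : Finset ℕ+}
    (h : Blocks (convolution 𝓕 𝓖) m D E) : ∃ n D', Blocks 𝓖 n D' E ∧ Blocks 𝓕 m D D' := by
  induction h with
  | empty => exact ⟨0, ∅, .empty, .empty⟩
  | @append m D E G h hG hne hb ih =>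
    obtain ⟨n, D', h1, h2⟩ := ih
    rcases mem_convolution_iff.1 hG with rfl | ⟨p, H, hH, hH'⟩
    · simp at hne
    have hHne : H.Nonempty := by
      rw [Finset.nonempty_iff_ne_empty] at hne ⊢
      rwa [Ne, hH.eq_empty_iff]
    refine ⟨n + p, D' ∪ H, h1.concat hH hb, ?_⟩
    rw [← hH.minElt_eq hne]
    exact h2.append hH' hHne fun a ha b hb' => hb a (h1.subset ha) b (hH.subset hb')

theorem Blocks.to_convolution {𝓕 𝓖 : Set (Finset ℕ+)} {m : ℕ} {D D' : Finset ℕ+}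
    (h : Blocks 𝓕 m D D') : ∀ {n E}, Blocks 𝓖 n D' E → Blocks (convolution 𝓕 𝓖) m D E := by
  induction h with
  | empty =>
    intro n E hE
    rw [hE.eq_empty_iff.1 rfl]
    exact .empty
  | @append m D D' H h hH hne hb ih =>
    intro n E hE
    obtain ⟨n₁, n₂, E₁, E₂, h1, h2, rfl, hb'⟩ := hE.split D' H rfl hb
    have hne2 : E₂.Nonempty := by
      rw [Finset.nonempty_iff_ne_empty] at hne ⊢
      rwa [Ne, ← h2.eq_empty_iff]
    rw [h2.minElt_eq hne2]
    exact (ih h1).append (mem_convolution_iff.2 (.inr ⟨n₂, H, h2, hH⟩)) hne2 hb'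

theorem convolution_succFamily (𝓕 𝓖 : Set (Finset ℕ+)) :
    convolution (succFamily 𝓕) 𝓖 = succFamily (convolution 𝓕 𝓖) := by
  have hp (m : ℕ) : ∀ a b : ℕ+, a ≤ b → m ≤ (a : ℕ) → m ≤ (b : ℕ) :=
    fun a b hab h => h.trans hab
  ext E
  rw [mem_convolution_iff]
  constructor
  · rintro (rfl | ⟨n, D', hE, m, D, hD, hm⟩)
    · exact ⟨0, ∅, .empty, by simp⟩
    · exact ⟨m, D, hD.to_convolution hE, (hE.forall_le_iff (hp m)).1 hm⟩
  · rintro ⟨m, D, hB, hm⟩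
    obtain ⟨n, D', h1, h2⟩ := hB.of_convolution
    exact .inr ⟨n, D', h1, m, D, h2, (h1.forall_le_iff (hp m)).2 hm⟩

theorem convolution_diagFamily (𝓕 : ℕ+ → Set (Finset ℕ+)) (𝓖 : Set (Finset ℕ+)) :
    convolution (diagFamily 𝓕) 𝓖 = diagFamily fun n => convolution (𝓕 n) 𝓖 := by
  ext E
  rw [mem_convolution_iff]
  constructor
  · rintro (rfl | ⟨n, D, hE, rfl | ⟨j, hj, hD⟩⟩)
    · exact .inl rfl
    · exact .inl (hE.eq_empty_iff.1 rfl)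
    · exact .inr ⟨j, (hE.forall_le_iff fun a b hab h => h.trans hab).1 hj,
        mem_convolution_iff.2 (.inr ⟨n, D, hE, hD⟩)⟩
  · rintro (rfl | ⟨j, hj, hE⟩)
    · exact .inl rfl
    · rcases mem_convolution_iff.1 hE with rfl | ⟨n, D, hE, hD⟩
      · exact .inl rfl
      · exact .inr ⟨n, D, hE, .inr ⟨j, (hE.forall_le_iff fun a b hab h => h.trans hab).2 hj, hD⟩⟩

/-- The families `𝓢_ζ[𝓖]` satisfy the Schreier recursion in `ζ`, started at `𝓖` instead of the
singletons. -/
theorem regular_convolution (c : FundamentalSequences) {𝓖 : Set (Finset ℕ+)} (h : Regular 𝓖)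
    (ζ : Ordinal) : Regular (convolution (schreier c ζ) 𝓖) := by
  induction ζ using Ordinal.limitRecOn with
  | zero => rwa [schreier_zero, convolution_singletons h.empty_mem]
  | add_one o ih => rw [schreier_succ, convolution_succFamily]; exact ih.succ
  | limit o ho ih =>
    rw [schreier_limit c ho, convolution_diagFamily]
    exact .diag fun n => ih _ (ho.add_one_lt (c.seq_lt o ho n))

theorem regular_schreier (c : FundamentalSequences) (ξ : Ordinal) : Regular (schreier c ξ) := by
  induction ξ using Ordinal.limitRecOn with
  | zero => rw [schreier_zero]; exact .schreier_zero
  | add_one o ih => rw [schreier_succ]; exact ih.succ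
  | limit o ho ih =>
    rw [schreier_limit c ho]
    exact .diag fun n => ih _ (ho.add_one_lt (c.seq_lt o ho n))

/-! ## Decompositions -/

open Classical in
-- Let `n` be the first point at which the initial segment of `M` leaves `𝓕`. The part below `n` is
-- in `𝓕`. By exchange, a proper extension of it in `𝓕` would allow appending `n`, so it is maximal.
theorem Regular.exists_max {𝓕 : Set (Finset ℕ+)} (h : Regular 𝓕) {M : Set ℕ+} (hM : M.Infinite) :
    ∃ E ∈ MAX 𝓕, E.Nonempty ∧ ↑E ⊆ M ∧ ∀ a ∈ E, ∀ b ∈ M, b ≤ a → b ∈ E := by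
  set J : ℕ+ → Finset ℕ+ := fun n => {k ∈ Finset.Iio n | k ∈ M} with hJ
  have mem_J {k n : ℕ+} : k ∈ J n ↔ k < n ∧ k ∈ M := by simp [hJ]
  have hne : {n ∈ M | insert n (J n) ∉ 𝓕}.Nonempty := by
    obtain ⟨E, hEM, hE⟩ := h.exists_notMem M hM
    have hE0 : E.Nonempty := by
      rw [Finset.nonempty_iff_ne_empty]
      rintro rfl
      exact hE h.empty_mem
    refine ⟨E.max' hE0, hEM (E.max'_mem hE0), fun h' => hE (h.hereditary _ h' _ fun k hk => ?_)⟩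
    rcases (E.le_max' k hk).eq_or_lt with hk' | hk'
    · exact hk' ▸ Finset.mem_insert_self _ _
    · exact Finset.mem_insert_of_mem (mem_J.2 ⟨hk', hEM hk⟩)
  obtain ⟨n, ⟨hnM, hn⟩, hmin⟩ := WellFounded.has_min (wellFounded_lt (α := ℕ+)) _ hne
  have hmin' : ∀ k ∈ M, k < n → insert k (J k) ∈ 𝓕 := fun k hk hkn => by
    by_contra hk'
    exact hmin k ⟨hk, hk'⟩ hkn
  have hJn0 : (J n).Nonempty := by
    rw [Finset.nonempty_iff_ne_empty]
    intro h0
    rw [h0] at hn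
    exact hn (h.singleton_mem n)
  have hJn : J n ∈ 𝓕 := by
    have hmax := mem_J.1 ((J n).max'_mem hJn0)
    refine h.hereditary _ (hmin' _ hmax.2 hmax.1) _ fun k hk => ?_
    rcases ((J n).le_max' k hk).eq_or_lt with hk' | hk'
    · exact hk' ▸ Finset.mem_insert_self _ _
    · exact Finset.mem_insert_of_mem (mem_J.2 ⟨hk', (mem_J.1 hk).2⟩)
  refine ⟨J n, ⟨hJn, fun F hF hJF => ?_⟩, hJn0, fun k hk => (mem_J.1 hk).2,
    fun a ha b hb hba => mem_J.2 ⟨hba.trans_lt (mem_J.1 ha).1, hb⟩⟩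
  by_contra hne
  obtain ⟨k, hkF, hk⟩ := Finset.not_subset.1 fun hsub => hne (hsub.antisymm hJF.1)
  refine hn (h.exchange (J n) k n (fun e he => ?_) (fun e he => (mem_J.1 he).1)
    (h.hereditary F hF _ (Finset.insert_subset hkF hJF.1)))
  by_contra! hke
  exact hk (hJF.2 e he k hkF hke)

theorem Regular.exists_decomposition {𝓕 : Set (Finset ℕ+)} (h : Regular 𝓕) {M : Set ℕ+}
    (hM : M.Infinite) : ∃ F, IsDecomposition 𝓕 M F := by
  choose E hE hne hsub hinit using fun M : {M : Set ℕ+ // M.Infinite} => h.exists_max M.2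
  let S : ℕ → {M : Set ℕ+ // M.Infinite} := fun k => Nat.rec ⟨M, hM⟩
    (fun _ N => ⟨N.1 \ E N, N.2.sdiff (E N).finite_toSet⟩) k
  have hS (k : ℕ) : (S (k + 1)).1 = (S k).1 \ E (S k) := rfl
  have hanti : Antitone fun k => (S k).1 :=
    antitone_nat_of_succ_le fun k => (hS k).symm ▸ Set.sdiff_subset
  have hbefore (i j : ℕ) (hij : i < j) : Before (E (S i)) (E (S j)) := by
    intro a ha b hb
    have hb' : b ∈ (S i).1 \ E (S i) := hS i ▸ hanti hij (hsub _ hb)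
    by_contra! hba
    exact hb'.2 (hinit _ a ha b hb'.1 hba)
  refine ⟨fun k => E (S k), fun k => hE _, hbefore, ?_⟩
  refine Set.Subset.antisymm (Set.iUnion_subset fun k => (hsub _).trans (hanti (Nat.zero_le k)))
    fun x hx => ?_
  by_contra hx'
  simp only [Set.mem_iUnion, not_exists] at hx'
  have hxS (k : ℕ) : x ∈ (S k).1 := by
    induction k with
    | zero => exact hx
    | succ k ih => exact hS k ▸ ⟨ih, hx' k⟩
  -- The minima strictly increase, so that of piece number `x` is at least `x`. A point `x` never
  -- removed would have to lie above it, since the piece is an initial segment of what remains.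
  have hmono : StrictMono fun k => ((minElt (E (S k)) : ℕ+) : ℕ) := fun i j hij =>
    hbefore i j hij _ (minElt_mem (hne _)) _ (minElt_mem (hne _))
  have h1 := hmono.le_apply (x := (x : ℕ))
  have h2 : minElt (E (S x)) < x := by
    by_contra! hle
    exact hx' _ (hinit _ _ (minElt_mem (hne _)) x (hxS _) hle)
  exact absurd h1 (not_le.2 h2)

/-- If the earlier pieces agree, the next two are initial segments of a common set up to `b`. One is
then an initial segment of the other, and maximality makes them equal. -/
theorem IsDecomposition.eq_of_agree {𝓕 : Set (Finset ℕ+)} {M M' : Set ℕ+} {F F' : ℕ → Finset ℕ+}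
    (hF : IsDecomposition 𝓕 M F) (hF' : IsDecomposition 𝓕 M' F') {b : ℕ+} {n : ℕ}
    (hb : ∀ i < n, ∀ k ∈ F i, k ≤ b) (hM : ∀ k ≤ b, k ∈ M ↔ k ∈ M') :
    ∀ i < n, F' i = F i := by
  intro i
  induction i using Nat.strong_induction_on with
  | _ i ih =>
  intro hi
  have mem {k : ℕ+} : k ∈ M ↔ ∃ j, k ∈ F j := by rw [← hF.2.2]; simp
  have mem' {k : ℕ+} : k ∈ M' ↔ ∃ j, k ∈ F' j := by rw [← hF'.2.2]; simp
  have ge' {k : ℕ+} {j l : ℕ} (hk : k ∈ F l) (hil : i ≤ l) (hj : k ∈ F' j) : i ≤ j := by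
    by_contra! hji
    rw [ih j hji (hji.trans hi)] at hj
    exact lt_irrefl _ (hF.2.1 j l (hji.trans_le hil) k hj k hk)
  have ge {k : ℕ+} {j l : ℕ} (hk : k ∈ F' l) (hil : i ≤ l) (hj : k ∈ F j) : i ≤ j := by
    by_contra! hji
    rw [← ih j hji (hji.trans hi)] at hj
    exact lt_irrefl _ (hF'.2.1 j l (hji.trans_le hil) k hj k hk)
  by_cases hsub : F i ⊆ F' i
  · refine (hF.1 i).2 (F' i) (hF'.1 i).1 ⟨hsub, fun a ha y hy hya => ?_⟩
    obtain ⟨j, hj⟩ := mem.1 ((hM y (hya.trans (hb i hi a ha))).2 (mem'.2 ⟨i, hy⟩))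
    rcases (ge hy le_rfl hj).eq_or_lt with rfl | hij
    · exact hj
    · exact absurd (hF.2.1 i j hij a ha y hj) hya.not_gt
  · obtain ⟨x, hx, hx'⟩ := Finset.not_subset.1 hsub
    have hxb := hb i hi x hx
    obtain ⟨j, hj⟩ := mem'.1 ((hM x hxb).1 (mem.2 ⟨i, hx⟩))
    have hij : i < j := lt_of_le_of_ne (ge' hx le_rfl hj) fun h => hx' (h ▸ hj)
    have hlt : ∀ y ∈ F' i, y < x := fun y hy => hF'.2.1 i j hij y hy x hj
    refine ((hF'.1 i).2 (F i) (hF.1 i).1 ⟨fun y hy => ?_, fun a ha y hy hya => ?_⟩).symm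
    · obtain ⟨l, hl⟩ := mem.1 ((hM y ((hlt y hy).le.trans hxb)).2 (mem'.2 ⟨i, hy⟩))
      rcases (ge hy le_rfl hl).eq_or_lt with rfl | hil
      · exact hl
      · exact absurd (hF.2.1 i l hil x hx y hl) (hlt y hy).not_gt
    · obtain ⟨l, hl⟩ := mem'.1 ((hM y (hb i hi y hy)).1 (mem.2 ⟨i, hy⟩))
      rcases (ge' hy le_rfl hl).eq_or_lt with rfl | hil
      · exact hl
      · exact absurd (hF'.2.1 i l hil a ha y hl) hya.not_gt

theorem Regular.isDecomposition {𝓕 : Set (Finset ℕ+)} (h : Regular 𝓕) {M : Set ℕ+}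
    (hM : M.Infinite) : IsDecomposition 𝓕 M (decomposition 𝓕 M) :=
  Classical.epsilon_spec (h.exists_decomposition hM)

theorem Regular.cut_subset {𝓕 : Set (Finset ℕ+)} (h : Regular 𝓕) {M : Set ℕ+}
    (hM : M.Infinite) (n : ℕ) : ↑(cut 𝓕 M n) ⊆ M := by
  intro k hk
  obtain ⟨i, -, hi⟩ := Finset.mem_biUnion.1 hk
  rw [← (h.isDecomposition hM).2.2]
  exact Set.mem_iUnion.2 ⟨i, hi⟩

theorem cut_mono (𝓕 : Set (Finset ℕ+)) (M : Set ℕ+) : Monotone (cut 𝓕 M) := fun _ _ hmn =>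
  Finset.biUnion_subset_biUnion_of_subset_left _ (Finset.range_mono hmn)

/-- Continuity of the cuts in `M`: this is what makes failure of a norm bound open. -/
theorem Regular.cut_eq_of_agree {𝓕 : Set (Finset ℕ+)} (h : Regular 𝓕) {M : Set ℕ+}
    (hM : M.Infinite) (n : ℕ) : ∃ b : ℕ+, ∀ M' : Set ℕ+, M'.Infinite →
      (∀ k ≤ b, k ∈ M ↔ k ∈ M') → ∀ i ≤ n, cut 𝓕 M' i = cut 𝓕 M i := by
  refine ⟨(cut 𝓕 M n).sup id ⊔ 1, fun M' hM' hagree i hi => ?_⟩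
  have := (h.isDecomposition hM).eq_of_agree (h.isDecomposition hM') (n := n)
    (fun i hi k hk => ?_) hagree
  · refine Finset.biUnion_congr rfl fun j hj => this j ?_
    exact (Finset.mem_range.1 hj).trans_le hi
  · refine le_sup_of_le_left (Finset.le_sup (f := id) (Finset.mem_biUnion.2 ⟨i, ?_, hk⟩))
    exact Finset.mem_range.2 hi

/-! ## Bounds for the weights -/

theorem abs_pWeight_le_one (c : FundamentalSequences) (ξ : Ordinal) (E : Finset ℕ+) :
    |pWeight c ξ E| ≤ 1 := by
  induction ξ using Ordinal.limitRecOn generalizing E with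
  | zero => simp [pWeight]
  | add_one o ih =>
    rw [pWeight, Ordinal.limitRecOn_add_one, abs_div]
    refine div_le_one_of_le₀ ((ih _).trans ?_) (abs_nonneg _)
    rw [Nat.abs_cast]
    exact_mod_cast (minElt _).pos
  | limit o ho ih =>
    rw [pWeight, Ordinal.limitRecOn_limit _ _ _ _ ho]
    exact ih _ (ho.add_one_lt (c.seq_lt o ho _)) _

theorem abs_qWeight_le_one (c : FundamentalSequences) (ξ ζ : Ordinal) (E : Finset ℕ+) :
    |qWeight c ξ ζ E| ≤ 1 := by
  induction ζ using Ordinal.limitRecOn generalizing E with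
  | zero => simp [qWeight]
  | add_one o ih =>
    rw [qWeight, Ordinal.limitRecOn_add_one, abs_div]
    refine div_le_one_of_le₀ ((ih _).trans ?_) (abs_nonneg _)
    rw [abs_of_nonneg (Real.sqrt_nonneg _), Real.one_le_sqrt]
    exact_mod_cast (minElt _).pos
  | limit o ho ih =>
    rw [qWeight, Ordinal.limitRecOn_limit _ _ _ _ ho]
    exact ih _ (ho.add_one_lt (c.seq_lt o ho _)) _

/-! ## Fusion and Ramsey's theorem for open sets -/

theorem exists_subset_forall_finset {ι : Type*} {R : ι → Set ℕ+ → Prop}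
    {L : Set ℕ+} (mono : ∀ s M M', M' ⊆ M → R s M → R s M')
    (dense : ∀ s, ∀ N ⊆ L, N.Infinite → ∃ M ⊆ N, M.Infinite ∧ R s M) (T : Finset ι) {N : Set ℕ+}
    (hNL : N ⊆ L) (hN : N.Infinite) : ∃ M ⊆ N, M.Infinite ∧ ∀ s ∈ T, R s M := by
  classical
  induction T using Finset.induction_on with
  | empty => exact ⟨N, subset_rfl, hN, by simp⟩
  | insert s T _ ih =>
    obtain ⟨M, hMN, hM, hT⟩ := ih
    obtain ⟨M', hM'M, hM', hs⟩ := dense s M (hMN.trans hNL) hM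
    refine ⟨M', hM'M.trans hMN, hM', fun r hr => ?_⟩
    rcases Finset.mem_insert.1 hr with rfl | hr
    · exact hs
    · exact mono r M M' hM'M (hT r hr)

/-- The fusion lemma. -/
theorem exists_fusion {R : Finset ℕ+ → Set ℕ+ → Prop} {L : Set ℕ+} (hL : L.Infinite)
    (mono : ∀ s M M', M' ⊆ M → R s M → R s M')
    (dense : ∀ s, ∀ N ⊆ L, N.Infinite → ∃ M ⊆ N, M.Infinite ∧ R s M) :
    ∃ M ⊆ L, M.Infinite ∧ ∀ s : Finset ℕ+, ↑s ⊆ M → R s {n ∈ M | ∀ k ∈ s, k < n} := by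
  -- A stage consists of the points chosen so far and an infinite reservoir, with `R` secured for
  -- every subset of the chosen points.
  let P := {p : Finset ℕ+ × Set ℕ+ // p.2 ⊆ L ∧ p.2.Infinite ∧ ∀ s ⊆ p.1, R s p.2}
  have step (p : P) : ∃ m ∈ p.1.2, ∃ q : P,
      q.1.1 = insert m p.1.1 ∧ q.1.2 ⊆ p.1.2 ∧ ∀ x ∈ q.1.2, m < x := by
    obtain ⟨m, hm⟩ := p.2.2.1.nonempty
    obtain ⟨M, hM, hMi, hR⟩ := exists_subset_forall_finset mono dense (insert m p.1.1).powerset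
      (N := {n ∈ p.1.2 | ∀ k ∈ ({m} : Finset ℕ+), k < n}) (fun x hx => p.2.1 hx.1)
      (infinite_inter_above p.2.2.1 _)
    exact ⟨m, hm, ⟨⟨insert m p.1.1, M⟩, fun x hx => p.2.1 (hM hx).1, hMi,
      fun s hs => hR s (Finset.mem_powerset.2 hs)⟩, rfl, fun x hx => (hM hx).1,
      fun x hx => (hM hx).2 m (by simp)⟩
  choose m hm q hq1 hq2 hq3 using step
  obtain ⟨M₀, hM₀, hM₀i, hR₀⟩ := dense ∅ L subset_rfl hL
  let S : ℕ → P := fun k => Nat.rec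
    ⟨⟨∅, M₀⟩, hM₀, hM₀i, fun s hs => by rwa [Finset.subset_empty.1 hs]⟩ (fun _ p => q p) k
  have hS (k : ℕ) : S (k + 1) = q (S k) := rfl
  have hanti : Antitone fun k => (S k).1.2 :=
    antitone_nat_of_succ_le fun k => hS k ▸ hq2 _
  have hmonot : Monotone fun k => (S k).1.1 := by
    refine monotone_nat_of_le_succ fun k => ?_
    rw [hS k, hq1]
    exact Finset.subset_insert _ _
  have hlt : StrictMono fun k => m (S k) := fun i j hij =>
    hq3 (S i) _ (hS i ▸ hanti hij (hm (S j)))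
  refine ⟨Set.range fun k => m (S k), ?_, Set.infinite_range_of_injective hlt.injective,
    fun s hs => ?_⟩
  · rintro _ ⟨k, rfl⟩
    exact (S k).2.1 (hm _)
  -- Stage `k` comes right after `max s` is chosen: `s` consists of points already chosen, and all
  -- points of the set beyond `s` come from the reservoir of that stage.
  · obtain ⟨k, hk1, hk2⟩ : ∃ k, (∀ i, m (S i) ∈ s → i < k) ∧
        ∀ i, (∀ x ∈ s, x < m (S i)) → k ≤ i := by
      rcases s.eq_empty_or_nonempty with rfl | hne
      · exact ⟨0, by simp, by simp⟩
      · obtain ⟨j, hj⟩ := hs (s.max'_mem hne)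
        simp only at hj
        refine ⟨j + 1, fun i hi => ?_, fun i hi => ?_⟩
        · exact Nat.lt_succ_of_le (hlt.le_iff_le.1 (by simpa only [hj] using s.le_max' _ hi))
        · exact hlt.lt_iff_lt.1 (by simpa only [hj] using hi _ (s.max'_mem hne))
    refine mono s _ _ ?_ ((S k).2.2.2 s fun x hx => ?_)
    · rintro _ ⟨⟨i, rfl⟩, hi⟩
      exact hanti (hk2 i hi) (hm _)
    · obtain ⟨i, rfl⟩ := hs hx
      refine hmonot (hk1 i hx) ?_
      simp only [hS, hq1]
      exact Finset.mem_insert_self _ _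

/-- Diagonalization over countably many conditions that ignore finite sets. -/
theorem exists_diagonal {ι : Type*} [Countable ι] {P : ι → Set ℕ+ → Prop} {L : Set ℕ+}
    (hL : L.Infinite)
    (mono : ∀ i M M', (M' \ M).Finite → P i M → P i M')
    (dense : ∀ i, ∀ N ⊆ L, N.Infinite → ∃ M ⊆ N, M.Infinite ∧ P i M) :
    ∃ M ⊆ L, M.Infinite ∧ ∀ i, P i M := by
  obtain ⟨e, he⟩ := Countable.exists_injective_nat ι
  -- At stage `s` only the finitely many conditions coded below an element of `s` are imposed. Each
  -- is thus met by a tail of `M`, hence by `M`.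
  obtain ⟨M, hML, hM, hR⟩ := exists_fusion (R := fun s M => ∀ i, (∃ k ∈ s, e i ≤ (k : ℕ)) → P i M)
    hL (fun s M M' hM' h i hi => mono i M M' (by simp [Set.sdiff_eq_empty.2 hM']) (h i hi))
    (fun s N hNL hN => by
      have hfin : {i | ∃ k ∈ s, e i ≤ (k : ℕ)}.Finite := by
        refine ((Set.finite_Iic ((s.sup id : ℕ+) : ℕ)).preimage he.injOn).subset ?_
        rintro i ⟨k, hk, hik⟩
        exact hik.trans (Finset.le_sup (f := id) hk : k ≤ s.sup id)
      obtain ⟨M, hMN, hM, h⟩ := exists_subset_forall_finset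
        (fun i M M' hM' => mono i M M' (by simp [Set.sdiff_eq_empty.2 hM'])) dense
        hfin.toFinset hNL hN
      exact ⟨M, hMN, hM, fun i hi => h i (hfin.mem_toFinset.2 hi)⟩)
  refine ⟨M, hML, hM, fun i => ?_⟩
  obtain ⟨k, hkM, hk⟩ := exists_mem_gt hM ⟨e i + 1, Nat.succ_pos _⟩
  have hk' : e i ≤ (k : ℕ) := (Nat.le_succ _).trans (show e i + 1 < (k : ℕ) from hk).le
  refine mono i _ _ ((Set.finite_Iic k).subset ?_)
    (hR {k} (by simpa using hkM) i ⟨k, Finset.mem_singleton_self _, hk'⟩)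
  rintro n ⟨hnM, hn⟩
  by_contra hnk
  exact hn ⟨hnM, by simpa using hnk⟩

/-- Open sets of infinite sets of positive integers are Ramsey. -/
theorem exists_homogeneous {O : Set ℕ+ → Prop} {L : Set ℕ+} (hL : L.Infinite)
    (hO : ∀ N : Set ℕ+, N.Infinite → O N →
      ∃ b : ℕ+, ∀ N' : Set ℕ+, N'.Infinite → (∀ k ≤ b, k ∈ N ↔ k ∈ N') → O N') :
    ∃ M ⊆ L, M.Infinite ∧
      ((∀ N ⊆ M, N.Infinite → O N) ∨ ∀ N ⊆ M, N.Infinite → ¬ O N) := by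
  classical
  -- `M` accepts `s` if all infinite continuations of `s` within `M` satisfy `O`, and rejects `s` if
  -- no infinite subset accepts it. The first fusion makes every finite `s ⊆ M₁` decided by its tail
  -- of `M₁`.
  let acc : Set ℕ+ → Finset ℕ+ → Prop := fun M s =>
    ∀ N ⊆ M, N.Infinite → (∀ k ∈ s, ∀ n ∈ N, k < n) → O (↑s ∪ N)
  let rej : Set ℕ+ → Finset ℕ+ → Prop := fun M s => ∀ N ⊆ M, N.Infinite → ¬ acc N s
  have acc_mono {M M' : Set ℕ+} {s : Finset ℕ+} (h : M' ⊆ M) (ha : acc M s) : acc M' s :=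
    fun N hN => ha N (hN.trans h)
  have rej_mono {M M' : Set ℕ+} {s : Finset ℕ+} (h : M' ⊆ M) (ha : rej M s) : rej M' s :=
    fun N hN => ha N (hN.trans h)
  obtain ⟨M₁, hM₁L, hM₁, hdec⟩ := exists_fusion (R := fun s M => acc M s ∨ rej M s) hL
    (fun s M M' h => Or.imp (acc_mono h) (rej_mono h)) (fun s N _ hN => by
      by_cases h : rej N s
      · exact ⟨N, subset_rfl, hN, .inr h⟩
      · simp only [rej, not_forall, not_not] at h
        obtain ⟨M, hMN, hM, h⟩ := h
        exact ⟨M, hMN, hM, .inl h⟩)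
  have habove (s : Finset ℕ+) : {n ∈ M₁ | ∀ k ∈ s, k < n} ⊆ M₁ := fun x hx => hx.1
  rcases hdec ∅ (by simp) with h0 | h0
  · refine ⟨M₁, hM₁L, hM₁, .inl fun N hN hNi => ?_⟩
    simpa using h0 N (fun x hx => ⟨hN hx, by simp⟩) hNi (by simp)
  -- only finitely many one-point extensions of a rejected set are accepted
  have hfin (s : Finset ℕ+) (hs : ↑s ⊆ M₁) (hrej : rej {n ∈ M₁ | ∀ k ∈ s, k < n} s) :
      {n ∈ M₁ | (∀ k ∈ s, k < n) ∧
        acc {j ∈ M₁ | ∀ k ∈ insert n s, k < j} (insert n s)}.Finite := by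
    by_contra hinf
    refine hrej _ (fun x hx => ⟨hx.1, hx.2.1⟩) hinf fun N hN hNi hsN => ?_
    obtain ⟨n, hnN, hn⟩ := WellFounded.has_min (wellFounded_lt (α := ℕ+)) N hNi.nonempty
    have hlt : ∀ x ∈ N \ {n}, n < x := fun x hx =>
      lt_of_le_of_ne (not_lt.1 (hn x hx.1)) fun h => hx.2 h.symm
    have hlt' : ∀ k ∈ insert n s, ∀ x ∈ N \ {n}, k < x := fun k hk x hx => by
      rcases Finset.mem_insert.1 hk with rfl | hk
      · exact hlt x hx
      · exact hsN k hk x hx.1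
    have := (hN hnN).2.2 (N \ {n}) (fun x hx => ⟨(hN hx.1).1, fun k hk => hlt' k hk x hx⟩)
      (hNi.sdiff (Set.finite_singleton n)) hlt'
    convert this using 1
    ext x
    by_cases hxn : x = n <;> simp [hxn, hnN]
  -- Deleting the finitely many accepted extensions at each stage makes rejection pass from `∅` to
  -- all finite subsets of `M₂`.
  obtain ⟨M₂, hM₂M₁, hM₂, hext⟩ := exists_fusion (L := M₁)
    (R := fun s M => ↑s ⊆ M₁ → rej {n ∈ M₁ | ∀ k ∈ s, k < n} s → ∀ n ∈ M, (∀ k ∈ s, k < n) →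
      rej {j ∈ M₁ | ∀ k ∈ insert n s, k < j} (insert n s)) hM₁
    (fun s M M' h hM hs hr n hn => hM hs hr n (h hn)) (fun s N hNM hN => by
      by_cases hs : ↑s ⊆ M₁ ∧ rej {n ∈ M₁ | ∀ k ∈ s, k < n} s
      · refine ⟨_, Set.sdiff_subset, hN.sdiff (hfin s hs.1 hs.2), fun _ _ n hn hsn => ?_⟩
        refine (hdec (insert n s) ?_).resolve_left fun hacc => hn.2 ⟨hNM hn.1, hsn, hacc⟩
        simpa [Set.insert_subset_iff] using ⟨hNM hn.1, hs.1⟩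
      · exact ⟨N, subset_rfl, hN, fun h1 h2 => absurd ⟨h1, h2⟩ hs⟩)
  have hall (s : Finset ℕ+) : ↑s ⊆ M₂ → rej {n ∈ M₁ | ∀ k ∈ s, k < n} s := by
    induction s using Finset.induction_on_max with
    | empty => exact fun _ => h0
    | insert n s hlt ih =>
      intro hs
      simp only [Finset.coe_insert, Set.insert_subset_iff] at hs
      exact hext s hs.2 (hs.2.trans hM₂M₁) (ih hs.2) n ⟨hs.1, hlt⟩ hlt
  refine ⟨M₂, hM₂M₁.trans hM₁L, hM₂, .inr fun N hN hNi hON => ?_⟩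
  -- By openness, the part of `N` up to `b` would be accepted by the tail of `M₁` beyond `b`,
  -- although it is rejected.
  obtain ⟨b, hb⟩ := hO N hNi hON
  set s : Finset ℕ+ := {k ∈ Finset.Iic b | k ∈ N} with hs
  have mem_s {k : ℕ+} : k ∈ s ↔ k ≤ b ∧ k ∈ N := by simp [hs]
  refine hall s (fun k hk => hN (mem_s.1 hk).2)
    {n ∈ M₁ | ∀ k ∈ insert b s, k < n} (fun x hx => ⟨hx.1, fun k hk => hx.2 k (by simp [hk])⟩)
    (infinite_inter_above hM₁ _) fun N' hN' hN'i hsN' => ?_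
  refine hb _ (hN'i.mono Set.subset_union_right) fun k hk => ?_
  have : k ∉ N' := fun h => ((hN' h).2 b (by simp)).not_ge hk
  simp [mem_s, hk, this]

/-! ## Rosenthal's theorem -/

theorem exists_strictMono_mem {S : ℕ → Set ℕ+} (hS : ∀ n, (S n).Infinite) :
    ∃ φ : ℕ → ℕ+, StrictMono φ ∧ ∀ n, φ n ∈ S n := by
  choose g hg hlt using fun n k => exists_mem_gt (hS n) k
  let φ : ℕ → ℕ+ := fun n => Nat.rec (g 0 1) (fun n k => g (n + 1) k) n
  refine ⟨φ, strictMono_nat_of_lt_succ fun n => hlt _ _, fun n => ?_⟩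
  cases n with
  | zero => exact hg _ _
  | succ n => exact hg _ _

theorem ncard_image_inter_Iio {φ : ℕ → ℕ+} (hφ : StrictMono φ) (J : ℕ → Prop) [DecidablePred J]
    (j : ℕ) : ((φ '' {i | J i}) ∩ Set.Iio (φ j)).ncard = Nat.count J j := by
  have : (φ '' {i | J i}) ∩ Set.Iio (φ j) = φ '' ↑({i ∈ Finset.range j | J i} : Finset ℕ) := by
    ext k
    constructor
    · rintro ⟨⟨i, hi, rfl⟩, hk⟩
      exact ⟨i, by simpa using ⟨hφ.lt_iff_lt.1 hk, hi⟩, rfl⟩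
    · rintro ⟨i, hi, rfl⟩
      simp only [Finset.coe_filter, Finset.mem_range, Set.mem_ofPred_eq] at hi
      exact ⟨⟨i, hi.2, rfl⟩, hφ hi.1⟩
  rw [this, Set.ncard_image_of_injective _ hφ.injective, Set.ncard_coe_finset,
    Nat.count_eq_card_filter_range]

/-- If on every infinite subset some `f` satisfies both `S f` and `T f` infinitely often, then there
is a sequence along which all finite patterns of `S` and `T` occur. -/
theorem exists_independent {K : Type*} {S T : K → ℕ+ → Prop} {M : Set ℕ+} (hM : M.Infinite)
    (h : ∀ N ⊆ M, N.Infinite → ∃ f, {k ∈ N | S f k}.Infinite ∧ {k ∈ N | T f k}.Infinite) :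
    ∃ y : ℕ → ℕ+, ∀ (n : ℕ) (ε : ℕ → Prop),
      ∃ f, ∀ i < n, (ε i → S f (y i)) ∧ (¬ ε i → T f (y i)) := by
  classical
  -- On every finite initial part of `N`, some `f` satisfies `S` and `T` alternately, according to
  -- the parity of the position. The negation is open.
  let good : Set ℕ+ → Prop := fun N => ∀ b : ℕ+, ∃ f, ∀ k ∈ N, k ≤ b →
    (Even (N ∩ Set.Iio k).ncard → S f k) ∧ (¬ Even (N ∩ Set.Iio k).ncard → T f k)
  obtain ⟨M', hM'M, hM', hgood⟩ := exists_homogeneous (O := fun N => ¬ good N) hM (by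
    intro N _ hN
    simp only [good, not_forall] at hN
    obtain ⟨b, hb⟩ := hN
    refine ⟨b, fun N' _ hNN' hN' => hb ?_⟩
    obtain ⟨f, hf⟩ := hN' b
    refine ⟨f, fun k hk hkb => ?_⟩
    have : N ∩ Set.Iio k = N' ∩ Set.Iio k := by
      ext j
      exact and_congr_left fun hj => hNN' j ((Set.mem_Iio.1 hj).le.trans hkb)
    rw [this]
    exact hf k ((hNN' k hkb).1 hk) hkb)
  replace hgood : ∀ N ⊆ M', N.Infinite → good N := by
    rcases hgood with hbad | hgood
    · exfalso
      obtain ⟨f, hS, hT⟩ := h M' hM'M hM'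
      obtain ⟨φ, hφ, hφS⟩ := exists_strictMono_mem
        (S := fun n => if Even n then {k ∈ M' | S f k} else {k ∈ M' | T f k})
        (fun n => by by_cases hn : Even n <;> simpa [hn])
      refine hbad (φ '' {i | True}) ?_ (Set.infinite_univ.image hφ.injective.injOn) fun b =>
        ⟨f, ?_⟩
      · rintro _ ⟨n, -, rfl⟩
        have := hφS n
        by_cases hn : Even n <;> simp only [hn, if_true, if_false] at this <;> exact this.1
      · rintro _ ⟨n, -, rfl⟩ -
        rw [ncard_image_inter_Iio hφ, Nat.count_true]
        have := hφS n
        by_cases hn : Even n <;> simp only [hn, if_true, if_false] at this <;> simp [hn, this.2]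
    · exact fun N hN hNi => not_not.1 (hgood N hN hNi)
  obtain ⟨m, hm, hmM⟩ := exists_strictMono_mem (S := fun _ => M') fun _ => hM'
  refine ⟨fun i => m (2 * i + 1), fun n ε => ?_⟩
  -- All odd positions are kept. Position `2 * i` is a filler, inserted exactly when it is needed to
  -- give `m (2 * i + 1)` the parity prescribed by `ε i`.
  let J : ℕ → Prop := fun j => j % 2 = 1 ∨
    (if j = 0 then ¬ ε 0 else (ε (j / 2) ↔ ε (j / 2 - 1)))
  have hJ (i : ℕ) : J (2 * i + 1) := .inl (by omega)
  have hcount (i : ℕ) : Even (Nat.count J (2 * i + 1)) ↔ ε i := by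
    induction i with
    | zero =>
      by_cases h0 : ε 0 <;> simp [Nat.count_succ, J, h0]
    | succ i ih =>
      have h2 : J (2 * i + 1 + 1) ↔ (ε (i + 1) ↔ ε i) := by
        have h3 : (2 * i + 1 + 1) % 2 = 0 := by omega
        have h4 : (2 * i + 1 + 1) / 2 = i + 1 := by omega
        simp only [J, h3, h4]
        simp
      rw [show 2 * (i + 1) + 1 = 2 * i + 1 + 1 + 1 by ring, Nat.count_succ, Nat.count_succ,
        if_pos (hJ i)]
      by_cases h5 : ε (i + 1) <;> by_cases h6 : ε i <;>
        simp [h2, h5, h6, Nat.even_add_one, ih]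
  have hNi : (m '' {j | J j}).Infinite := by
    refine Set.Infinite.image hm.injective.injOn ?_
    refine (Set.infinite_range_of_injective (f := fun i : ℕ => 2 * i + 1)
      (fun i j hij => by simpa using hij)).mono ?_
    rintro _ ⟨i, rfl⟩
    exact hJ i
  obtain ⟨f, hf⟩ := hgood (m '' {j | J j}) (by rintro _ ⟨j, -, rfl⟩; exact hmM j) hNi
    (m (2 * n + 1))
  refine ⟨f, fun i hi => ?_⟩
  have := hf (m (2 * i + 1)) ⟨_, hJ i, rfl⟩ (hm.monotone (by omega))
  rwa [ncard_image_inter_Iio hm, hcount] at this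

section Rosenthal

variable {𝕜 : Type*} [RCLike 𝕜]
variable {X : Type*} [NormedAddCommGroup X] [NormedSpace 𝕜 X]

theorem norm_le_abs_re_add_abs_im (z : 𝕜) : ‖z‖ ≤ |RCLike.re z| + |RCLike.im z| := by
  refine abs_le_of_sq_le_sq' ?_ (by positivity) |>.2
  rw [sq, RCLike.mul_self_norm, RCLike.normSq_apply]
  nlinarith [abs_mul_abs_self (RCLike.re z), abs_mul_abs_self (RCLike.im z),
    mul_nonneg (abs_nonneg (RCLike.re z)) (abs_nonneg (RCLike.im z))]

/-- For signs `σ`, let `f` follow the pattern and `g` the opposite one: `f - g` has norm at most `2`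
and is within `‖d‖ / 4` of `σ i * d` at `y i`. Taking the signs of the real and then of the
imaginary parts of `a i * d` and adding gives `‖d‖ ∑ ‖a i‖ ≤ 4 ‖∑ a i • y i‖ + (‖d‖ / 2) ∑ ‖a i‖`,
whence the factor `1 / 8`. -/
theorem lower_estimate_of_independent {c₁ c₂ : 𝕜} {y : ℕ → X} {n : ℕ}
    (h : ∀ ε : ℕ → Prop, ∃ f : X →L[𝕜] 𝕜, ‖f‖ ≤ 1 ∧ ∀ i < n,
      (ε i → ‖f (y i) - c₁‖ ≤ ‖c₁ - c₂‖ / 8) ∧ (¬ ε i → ‖f (y i) - c₂‖ ≤ ‖c₁ - c₂‖ / 8))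
    (a : ℕ → 𝕜) :
    ‖c₁ - c₂‖ / 8 * ∑ i ∈ Finset.range n, ‖a i‖ ≤ ‖∑ i ∈ Finset.range n, a i • y i‖ := by
  classical
  set d := c₁ - c₂ with hd
  have key (σ : ℕ → 𝕜) (hσ : ∀ i, σ i = 1 ∨ σ i = -1) :
      ‖∑ i ∈ Finset.range n, a i * (σ i * d)‖ ≤
        2 * ‖∑ i ∈ Finset.range n, a i • y i‖ + ‖d‖ / 4 * ∑ i ∈ Finset.range n, ‖a i‖ := by
    obtain ⟨f, hf1, hf⟩ := h fun i => σ i = 1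
    obtain ⟨g, hg1, hg⟩ := h fun i => ¬ σ i = 1
    have hfg (i : ℕ) (hi : i < n) : ‖(f - g) (y i) - σ i * d‖ ≤ ‖d‖ / 4 := by
      rcases hσ i with h1 | h1
      · have e : (f - g) (y i) - σ i * d = (f (y i) - c₁) - (g (y i) - c₂) := by
          rw [h1, hd, _root_.sub_apply]; ring
        rw [e]
        refine (norm_sub_le _ _).trans ?_
        linarith [(hf i hi).1 h1, (hg i hi).2 (not_not.2 h1)]
      · have h2 : ¬ σ i = 1 := by
          rw [h1]
          intro h3
          have h4 := congrArg RCLike.re h3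
          simp only [map_neg, RCLike.one_re] at h4
          linarith
        have e : (f - g) (y i) - σ i * d = (f (y i) - c₂) - (g (y i) - c₁) := by
          rw [h1, hd, _root_.sub_apply]; ring
        rw [e]
        refine (norm_sub_le _ _).trans ?_
        linarith [(hf i hi).2 h2, (hg i hi).1 h2]
    have e : ∑ i ∈ Finset.range n, a i * (σ i * d) =
        (f - g) (∑ i ∈ Finset.range n, a i • y i) -
          ∑ i ∈ Finset.range n, a i * ((f - g) (y i) - σ i * d) := by
      rw [map_sum, ← Finset.sum_sub_distrib]
      exact Finset.sum_congr rfl fun i _ => by rw [map_smul, _root_.smul_eq_mul]; ring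
    rw [e]
    refine (norm_sub_le _ _).trans (add_le_add ?_ ?_)
    · refine ((f - g).le_opNorm _).trans (mul_le_mul_of_nonneg_right ?_ (norm_nonneg _))
      exact (norm_sub_le _ _).trans (by linarith)
    · refine (norm_sum_le _ _).trans ?_
      rw [Finset.mul_sum]
      refine Finset.sum_le_sum fun i hi => ?_
      rw [norm_mul, mul_comm]
      exact mul_le_mul_of_nonneg_right (hfg i (Finset.mem_range.1 hi)) (norm_nonneg _)
  have hre : ∑ i ∈ Finset.range n, |RCLike.re (a i * d)| ≤
      2 * ‖∑ i ∈ Finset.range n, a i • y i‖ + ‖d‖ / 4 * ∑ i ∈ Finset.range n, ‖a i‖ := by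
    refine le_trans ?_ (key (fun i => if 0 ≤ RCLike.re (a i * d) then 1 else -1)
      fun i => by split_ifs <;> simp)
    refine le_trans (le_of_eq ?_) (RCLike.re_le_norm _)
    rw [map_sum]
    refine Finset.sum_congr rfl fun i _ => ?_
    split_ifs with h
    · rw [abs_of_nonneg h, one_mul]
    · rw [abs_of_neg (not_le.1 h), neg_one_mul, mul_neg, map_neg]
  have him : ∑ i ∈ Finset.range n, |RCLike.im (a i * d)| ≤
      2 * ‖∑ i ∈ Finset.range n, a i • y i‖ + ‖d‖ / 4 * ∑ i ∈ Finset.range n, ‖a i‖ := by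
    refine le_trans ?_ (key (fun i => if 0 ≤ RCLike.im (a i * d) then 1 else -1)
      fun i => by split_ifs <;> simp)
    refine le_trans (le_of_eq ?_) (RCLike.im_le_norm _)
    rw [map_sum]
    refine Finset.sum_congr rfl fun i _ => ?_
    split_ifs with h
    · rw [abs_of_nonneg h, one_mul]
    · rw [abs_of_neg (not_le.1 h), neg_one_mul, mul_neg, map_neg]
  have hsum : ‖d‖ * ∑ i ∈ Finset.range n, ‖a i‖ ≤
      ∑ i ∈ Finset.range n, |RCLike.re (a i * d)| + ∑ i ∈ Finset.range n, |RCLike.im (a i * d)| := by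
    rw [Finset.mul_sum, ← Finset.sum_add_distrib]
    refine Finset.sum_le_sum fun i _ => ?_
    rw [mul_comm, ← norm_mul]
    exact norm_le_abs_re_add_abs_im _
  linarith

theorem containsEllOne_of_lower_estimate [CompleteSpace X] {y : ℕ → X} {C δ : ℝ}
    (hC : ∀ i, ‖y i‖ ≤ C) (hδ : 0 < δ)
    (h : ∀ (n : ℕ) (a : ℕ → 𝕜),
      δ * ∑ i ∈ Finset.range n, ‖a i‖ ≤ ‖∑ i ∈ Finset.range n, a i • y i‖) :
    ContainsEllOne 𝕜 X := by
  have hsum (a : lp (fun _ : ℕ => 𝕜) 1) : Summable fun i => ‖a i‖ := by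
    simpa using (lp.memℓp a).summable (by simp)
  have hnorm (a : lp (fun _ : ℕ => 𝕜) 1) : ‖a‖ = ∑' i, ‖a i‖ := by
    simpa using lp.norm_eq_tsum_rpow (by simp) a
  have hbound (a : lp (fun _ : ℕ => 𝕜) 1) (i : ℕ) : ‖a i • y i‖ ≤ ‖a i‖ * C := by
    rw [norm_smul]
    exact mul_le_mul_of_nonneg_left (hC i) (norm_nonneg _)
  have hsum' (a : lp (fun _ : ℕ => 𝕜) 1) : Summable fun i => a i • y i :=
    .of_norm_bounded ((hsum a).mul_right C) (hbound a)
  let J : lp (fun _ : ℕ => 𝕜) 1 →ₗ[𝕜] X :=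
    { toFun := fun a => ∑' i, a i • y i
      map_add' := fun a b => by
        rw [← (hsum' a).tsum_add (hsum' b)]
        simp [add_smul]
      map_smul' := fun r a => by
        rw [RingHom.id_apply, ← (hsum' a).tsum_const_smul]
        simp [mul_smul] }
  refine ⟨J.mkContinuous C fun a => ?_, δ, hδ, fun a => ?_⟩
  · rw [hnorm, mul_comm, ← tsum_mul_right]
    exact tsum_of_norm_bounded ((hsum a).mul_right C).hasSum (hbound a)
  · rw [hnorm]
    exact le_of_tendsto_of_tendsto' ((hsum a).hasSum.tendsto_sum_nat.const_mul δ)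
      ((hsum' a).hasSum.tendsto_sum_nat.norm) fun n => h n fun i => a i

theorem frequently_inf_principal_iff {M : Set ℕ+} {p : ℕ+ → Prop} :
    (∃ᶠ k in atTop ⊓ 𝓟 M, p k) ↔ {k ∈ M | p k}.Infinite := by
  rw [Filter.frequently_inf_principal, Filter.frequently_atTop]
  constructor
  · refine fun h => Set.infinite_of_forall_exists_gt fun a => ?_
    obtain ⟨b, hab, hb⟩ := h (a + 1)
    exact ⟨b, hb, PNat.add_one_le_iff.1 hab⟩
  · intro h a
    obtain ⟨b, hb, hab⟩ := exists_mem_gt h a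
    exact ⟨b, hab.le, hb⟩

theorem neBot_atTop_inf_principal {M : Set ℕ+} (hM : M.Infinite) : (atTop ⊓ 𝓟 M).NeBot := by
  rw [← Filter.frequently_true_iff_neBot, frequently_inf_principal_iff]
  simpa using hM

/-- Rosenthal's `ℓ₁` theorem. -/
theorem exists_weaklyCauchy [CompleteSpace X] (hX : ¬ ContainsEllOne 𝕜 X) {x : ℕ+ → X} {C : ℝ}
    (hC : ∀ k, ‖x k‖ ≤ C) {L : Set ℕ+} (hL : L.Infinite) :
    ∃ M ⊆ L, M.Infinite ∧
      ∀ f : X →L[𝕜] 𝕜, ∃ a, Tendsto (fun k => f (x k)) (atTop ⊓ 𝓟 M) (𝓝 a) := by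
  let z : ℕ → 𝕜 := TopologicalSpace.denseSeq 𝕜
  let r : ℕ × ℕ → ℝ := fun i => ‖z i.1 - z i.2‖ / 8
  -- Countably many pairs of discs with dense centres suffice to separate two cluster points. If
  -- some pair cannot be avoided on any infinite subset, independence produces `ℓ₁`.
  obtain ⟨M, hML, hM, hP⟩ := exists_diagonal (ι := {i : ℕ × ℕ // z i.1 ≠ z i.2})
    (P := fun i M => ∀ f : X →L[𝕜] 𝕜, ‖f‖ ≤ 1 →
      ¬ ({k ∈ M | ‖f (x k) - z i.1.1‖ ≤ r i}.Infinite ∧ {k ∈ M | ‖f (x k) - z i.1.2‖ ≤ r i}.Infinite))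
    hL (by
      intro i M M' hfin h f hf hinf
      have aux (p : ℕ+ → Prop) (hp : {k ∈ M' | p k}.Infinite) : {k ∈ M | p k}.Infinite := by
        refine (hp.sdiff hfin).mono ?_
        rintro k ⟨⟨hk, hpk⟩, hk'⟩
        exact ⟨by_contra fun hkM => hk' ⟨hk, hkM⟩, hpk⟩
      exact h f hf ⟨aux _ hinf.1, aux _ hinf.2⟩)
    (by
      rintro ⟨i, hi⟩ N - hN
      by_contra! hcon
      obtain ⟨y, hy⟩ := exists_independent (K := {f : X →L[𝕜] 𝕜 // ‖f‖ ≤ 1})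
        (S := fun f k => ‖f.1 (x k) - z i.1‖ ≤ r i) (T := fun f k => ‖f.1 (x k) - z i.2‖ ≤ r i) hN
        (by
          intro N' hN' hN'i
          obtain ⟨f, hf, h1, h2⟩ := hcon N' hN' hN'i
          exact ⟨⟨f, hf⟩, h1, h2⟩)
      refine hX (containsEllOne_of_lower_estimate (y := fun i => x (y i)) (fun i => hC _)
        (show 0 < r i from div_pos (norm_pos_iff.2 (sub_ne_zero.2 hi)) (by norm_num)) fun n a => ?_)
      refine lower_estimate_of_independent (fun ε => ?_) a
      obtain ⟨f, hf⟩ := hy n ε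
      exact ⟨f.1, f.2, hf⟩)
  refine ⟨M, hML, hM, ?_⟩
  have := neBot_atTop_inf_principal hM
  have hball (f : X →L[𝕜] 𝕜) (hf : ‖f‖ ≤ 1) :
      ∃ a, Tendsto (fun k => f (x k)) (atTop ⊓ 𝓟 M) (𝓝 a) := by
    have hmem : ∀ k, f (x k) ∈ Metric.closedBall (0 : 𝕜) C := fun k => by
      rw [mem_closedBall_zero_iff]
      refine (f.le_opNorm _).trans ?_
      exact (mul_le_of_le_one_left (norm_nonneg _) hf).trans (hC k)
    have hK := isCompact_closedBall (0 : 𝕜) C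
    obtain ⟨a, -, ha⟩ := hK.exists_mapClusterPt (f := atTop ⊓ 𝓟 M) (u := fun k => f (x k))
      (le_principal_iff.2 (Filter.mem_map.2 (Filter.univ_mem' hmem)))
    refine ⟨a, hK.tendsto_nhds_of_unique_mapClusterPt (Filter.Eventually.of_forall hmem) fun b _ hb => ?_⟩
    by_contra hab
    have hpos : 0 < ‖a - b‖ := norm_pos_iff.2 (sub_ne_zero.2 (Ne.symm hab))
    -- Such centres are at least `98 / 100` of `‖a - b‖` apart, so an eighth of their distance
    -- exceeds the `2 / 100` needed below.
    have hdense (w : 𝕜) : ∃ i, ‖w - z i‖ < ‖a - b‖ / 100 := by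
      obtain ⟨i, hi⟩ := (TopologicalSpace.denseRange_denseSeq 𝕜).exists_dist_lt w
        (div_pos hpos (by norm_num : (0 : ℝ) < 100))
      exact ⟨i, by rwa [← dist_eq_norm]⟩
    obtain ⟨i, hi⟩ := hdense a
    obtain ⟨j, hj⟩ := hdense b
    have hij : ‖a - b‖ ≤ ‖a - z i‖ + ‖z i - z j‖ + ‖b - z j‖ := by
      have e : a - b = (a - z i) + (z i - z j) - (b - z j) := by ring
      calc ‖a - b‖ = _ := congrArg _ e
        _ ≤ _ := (norm_sub_le _ _).trans (by gcongr; exact norm_add_le _ _)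
    have hne : z i ≠ z j := by
      intro h
      rw [h, _root_.sub_self, norm_zero] at hij
      rw [h] at hi
      linarith
    have aux (w : 𝕜) (l : ℕ) (hw : MapClusterPt w (atTop ⊓ 𝓟 M) fun k => f (x k))
        (hl : ‖w - z l‖ < ‖a - b‖ / 100) : {k ∈ M | ‖f (x k) - z l‖ ≤ r (i, j)}.Infinite := by
      rw [← frequently_inf_principal_iff]
      refine (hw.frequently (Metric.ball_mem_nhds w
        (div_pos hpos (by norm_num : (0 : ℝ) < 100)))).mono fun k hk => ?_
      rw [dist_eq_norm] at hk
      have e : f (x k) - z l = (f (x k) - w) + (w - z l) := by ring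
      rw [e]
      refine (norm_add_le _ _).trans ?_
      simp only [r]
      linarith
    exact hP ⟨(i, j), hne⟩ f hf ⟨aux a i ha hi, aux b j hb hj⟩
  intro f
  have hpos : 0 < ‖f‖ + 1 := by positivity
  obtain ⟨a, ha⟩ := hball (((‖f‖ + 1 : ℝ) : 𝕜)⁻¹ • f) (by
    rw [norm_smul, norm_inv, RCLike.norm_ofReal, abs_of_pos hpos, inv_mul_le_one₀ hpos]
    linarith)
  refine ⟨((‖f‖ + 1 : ℝ) : 𝕜) * a, (ha.const_mul ((‖f‖ + 1 : ℝ) : 𝕜)).congr fun k => ?_⟩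
  rw [_root_.smul_apply, _root_.smul_eq_mul, mul_inv_cancel_left₀]
  exact_mod_cast hpos.ne'

end Rosenthal

/-! ## Weakly summing norms -/

section Banach

variable {𝕜 : Type*} [RCLike 𝕜]
variable {T : Type*} [NormedAddCommGroup T] [NormedSpace 𝕜 T]
variable {U : Type*} [NormedAddCommGroup U] [NormedSpace 𝕜 U]
variable {V : Type*} [NormedAddCommGroup V] [NormedSpace 𝕜 V]
variable {W : Type*} [NormedAddCommGroup W] [NormedSpace 𝕜 W]

theorem tsum_rpow_le_iff {a : ℕ → ℝ≥0∞} {p : ℝ} (hp : 0 < p) {γ : ℝ≥0∞} :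
    (∑' i, a i ^ p) ^ (1 / p) ≤ γ ↔ ∀ n, (∑ i ∈ Finset.range n, a i ^ p) ^ (1 / p) ≤ γ := by
  rw [one_div]
  simp only [ENNReal.rpow_inv_le_iff hp]
  rw [ENNReal.tsum_eq_iSup_nat, iSup_le_iff]

theorem weakNorm_le_iff {p : ℝ} {e : ℕ → V} {γ : ℝ≥0∞} :
    weakNorm 𝕜 p e ≤ γ ↔ ∀ f : V →L[𝕜] 𝕜, ‖f‖ ≤ 1 → (∑' i, ‖f (e i)‖ₑ ^ p) ^ (1 / p) ≤ γ :=
  iSup₂_le_iff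

theorem le_mul_weakNorm {p : ℝ} (hp : 0 < p) (f : V →L[𝕜] 𝕜) (e : ℕ → V) :
    (∑' i, ‖f (e i)‖ₑ ^ p) ^ (1 / p) ≤ ‖f‖ₑ * weakNorm 𝕜 p e := by
  rcases eq_or_ne f 0 with rfl | hf
  · simp [ENNReal.zero_rpow_of_pos, hp]
  have hf' : ‖f‖ ≠ 0 := norm_ne_zero_iff.2 hf
  have key := weakNorm_le_iff.1 (le_refl (weakNorm 𝕜 p e)) (((‖f‖ : ℝ) : 𝕜)⁻¹ • f) (by
    rw [norm_smul, norm_inv, RCLike.norm_ofReal, abs_norm, inv_mul_cancel₀ hf'])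
  refine le_trans (le_of_eq ?_) (mul_le_mul_right key ‖f‖ₑ)
  have h (i : ℕ) : ‖f (e i)‖ₑ ^ p =
      ‖f‖ₑ ^ p * ‖((((‖f‖ : ℝ) : 𝕜)⁻¹ • f : V →L[𝕜] 𝕜)) (e i)‖ₑ ^ p := by
    rw [← ENNReal.mul_rpow_of_nonneg _ _ hp.le]
    congr 1
    have h1 : f (e i) = ((‖f‖ : ℝ) : 𝕜) * ((((‖f‖ : ℝ) : 𝕜)⁻¹ • f : V →L[𝕜] 𝕜)) (e i) := by
      rw [_root_.smul_apply, _root_.smul_eq_mul, mul_inv_cancel_left₀]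
      exact_mod_cast hf'
    conv_lhs => rw [h1, enorm_mul]
    congr 1
    simp [enorm_eq_nnnorm]
  simp only [h]
  rw [ENNReal.tsum_mul_left, ENNReal.mul_rpow_of_nonneg _ _ (by positivity),
    ← ENNReal.rpow_mul, mul_one_div_cancel hp.ne', ENNReal.rpow_one]

theorem weakNorm_comp_le {p : ℝ} (hp : 0 < p) (A : V →L[𝕜] W) (e : ℕ → V) :
    weakNorm 𝕜 p (fun n => A (e n)) ≤ ‖A‖ₑ * weakNorm 𝕜 p e := by
  refine weakNorm_le_iff.2 fun f hf => (le_mul_weakNorm hp (f.comp A) e).trans ?_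
  gcongr
  rw [enorm_le_iff_norm_le]
  exact (f.opNorm_comp_le A).trans (mul_le_of_le_one_left (norm_nonneg _) hf)

theorem weakNorm_add_le {p : ℝ} (hp : 1 ≤ p) (e e' : ℕ → V) :
    weakNorm 𝕜 p (fun n => e n + e' n) ≤ weakNorm 𝕜 p e + weakNorm 𝕜 p e' := by
  have hp0 := zero_lt_one.trans_le hp
  refine weakNorm_le_iff.2 fun f hf => (tsum_rpow_le_iff hp0).2 fun n => ?_
  refine le_trans ?_ ((ENNReal.Lp_add_le (Finset.range n) (fun i => ‖f (e i)‖ₑ)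
    (fun i => ‖f (e' i)‖ₑ) hp).trans (add_le_add
      ((tsum_rpow_le_iff hp0).1 (weakNorm_le_iff.1 le_rfl f hf) n)
      ((tsum_rpow_le_iff hp0).1 (weakNorm_le_iff.1 le_rfl f hf) n)))
  gcongr with i
  rw [map_add]
  exact enorm_add_le _ _

/-- A functional of norm at most `1` on `V` becomes one of norm at most `δ⁻¹` on the range of `j`;
Hahn–Banach extends it to `W`. -/
theorem weakNorm_le_of_embedding {p : ℝ} (hp : 0 < p) {j : V →L[𝕜] W} {δ : ℝ} (hδ : 0 < δ)
    (hj : ∀ x, δ * ‖x‖ ≤ ‖j x‖) (e : ℕ → V) :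
    weakNorm 𝕜 p e ≤ ENNReal.ofReal δ⁻¹ * weakNorm 𝕜 p fun n => j (e n) := by
  refine weakNorm_le_iff.2 fun f hf => ?_
  have hinj : Function.Injective j := by
    refine (injective_iff_map_eq_zero j).2 fun x hx => norm_le_zero_iff.1 ?_
    have := hj x
    rw [hx, norm_zero] at this
    exact nonpos_of_mul_nonpos_right this hδ
  let i := LinearEquiv.ofInjective (j : V →ₗ[𝕜] W) hinj
  let φ : LinearMap.range (j : V →ₗ[𝕜] W) →L[𝕜] 𝕜 :=
    ((f : V →ₗ[𝕜] 𝕜).comp i.symm.toLinearMap).mkContinuous δ⁻¹ fun z => by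
      obtain ⟨x, rfl⟩ := i.surjective z
      simp only [LinearMap.comp_apply, LinearEquiv.coe_coe, LinearEquiv.symm_apply_apply]
      have h1 : ‖i x‖ = ‖j x‖ := rfl
      rw [h1, ← div_eq_inv_mul, le_div_iff₀' hδ]
      refine le_trans ?_ (hj x)
      exact mul_le_mul_of_nonneg_left ((f.le_opNorm x).trans
        (mul_le_of_le_one_left (norm_nonneg _) hf)) hδ.le
  obtain ⟨g, hg, hgn⟩ := exists_extension_norm_eq _ φ
  have hgj (x : V) : f x = g (j x) := by
    have h1 := hg (i x)
    have h2 : φ (i x) = f x := by simp [φ]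
    rw [← h2, ← h1]
    rfl
  simp only [hgj]
  refine (le_mul_weakNorm hp g fun n => j (e n)).trans ?_
  gcongr
  rw [← ofReal_norm]
  refine ENNReal.ofReal_le_ofReal ?_
  rw [hgn]
  exact LinearMap.mkContinuous_norm_le _ (by positivity) _

theorem weakNorm_zero {p : ℝ} (hp : 0 < p) : weakNorm 𝕜 p (fun _ => (0 : V)) = 0 := by
  refine le_antisymm (weakNorm_le_iff.2 fun f _ => ?_) bot_le
  simp [ENNReal.zero_rpow_of_pos, hp]

theorem weakNorm_le_one_of_sum_norm_le {p : ℝ} (hp : 1 ≤ p) {e : ℕ → V}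
    (he : ∀ n, ∑ i ∈ Finset.range n, ‖e i‖ ≤ 1) : weakNorm 𝕜 p e ≤ 1 := by
  have hp0 := zero_lt_one.trans_le hp
  refine weakNorm_le_iff.2 fun f hf => (tsum_rpow_le_iff hp0).2 fun n => ?_
  have hle (i : ℕ) : ‖f (e i)‖ₑ ≤ ‖e i‖ₑ := by
    rw [enorm_le_iff_norm_le]
    exact (f.le_opNorm _).trans (mul_le_of_le_one_left (norm_nonneg _) hf)
  have hone (i : ℕ) : ‖e i‖ₑ ≤ 1 := by
    rw [← ofReal_norm, ENNReal.ofReal_le_one]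
    exact (Finset.single_le_sum (f := fun i => ‖e i‖) (fun _ _ => norm_nonneg _)
      (Finset.self_mem_range_succ i)).trans (he (i + 1))
  refine ENNReal.rpow_le_one ?_ (by positivity)
  calc ∑ i ∈ Finset.range n, ‖f (e i)‖ₑ ^ p ≤ ∑ i ∈ Finset.range n, ‖e i‖ₑ := by
        gcongr with i
        exact (ENNReal.rpow_le_self_of_le_one ((hle i).trans (hone i)) hp).trans (hle i)
    _ = ENNReal.ofReal (∑ i ∈ Finset.range n, ‖e i‖) := by
        rw [ENNReal.ofReal_sum_of_nonneg fun _ _ => norm_nonneg _]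
        simp only [ofReal_norm]
    _ ≤ 1 := ENNReal.ofReal_le_one.2 (he n)

/-! ## Block sums -/

theorem map_blockSum (A : U →L[𝕜] V) (𝓕 : Set (Finset ℕ+)) (w : Finset ℕ+ → ℝ) (N : Set ℕ+)
    (u : Finset ℕ+ → U) (n : ℕ) :
    A (blockSum 𝕜 𝓕 w N u n) = blockSum 𝕜 𝓕 w N (fun E => A (u E)) n := by
  simp only [blockSum, map_sum, map_smul]

theorem blockSum_smul (a : 𝕜) (𝓕 : Set (Finset ℕ+)) (w : Finset ℕ+ → ℝ) (N : Set ℕ+)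
    (u : Finset ℕ+ → U) (n : ℕ) :
    blockSum 𝕜 𝓕 w N (fun E => a • u E) n = a • blockSum 𝕜 𝓕 w N u n := by
  simp only [blockSum, Finset.smul_sum, smul_comm a]

theorem ProperInitSeg.nonempty {E F : Finset ℕ+} (h : ProperInitSeg E F) : F.Nonempty := by
  rw [Finset.nonempty_iff_ne_empty]
  rintro rfl
  exact h.2 (Finset.subset_empty.1 h.1.1)

open Classical in
theorem Regular.blockSum_congr {𝓕 : Set (Finset ℕ+)} (h : Regular 𝓕) (w : Finset ℕ+ → ℝ)
    {M : Set ℕ+} (hM : M.Infinite) {u u' : Finset ℕ+ → U}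
    (hu : ∀ E : Finset ℕ+, E.Nonempty → ↑E ⊆ M → u E = u' E) (n : ℕ) :
    blockSum 𝕜 𝓕 w M u n = blockSum 𝕜 𝓕 w M u' n := by
  refine Finset.sum_congr rfl fun E hE => ?_
  obtain ⟨hE1, hE2, -⟩ := Finset.mem_filter.1 hE
  rw [hu E hE2.nonempty ((Finset.coe_subset.2 (Finset.mem_powerset.1 hE1)).trans
    (h.cut_subset hM _))]

/-! ## The common form of the two properties -/

variable (𝕜) in
/-- The property defined by the `𝓕`-block sums with weights `w` and the weakly `p`-summing norm. -/
def HasBlock (𝓕 : Set (Finset ℕ+)) (w : Finset ℕ+ → ℝ) (p : ℝ) (γ : ℝ≥0) (A : U →L[𝕜] V) : Prop :=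
  ∀ u : Finset ℕ+ → U, (∀ E, E.Nonempty → ‖u E‖ ≤ 1) → WeaklyNull 𝕜 u →
    ∀ L : Set ℕ+, L.Infinite → ∃ M ⊆ L, M.Infinite ∧
      weakNorm 𝕜 p (fun n => A (blockSum 𝕜 𝓕 w M u n)) ≤ γ

variable {𝓕 : Set (Finset ℕ+)} {w : Finset ℕ+ → ℝ} {p : ℝ} {γ : ℝ≥0}

/-- The property holds hereditarily. -/
theorem HasBlock.exists_forall (h𝓕 : Regular 𝓕) (hp : 0 < p) {A : U →L[𝕜] V}
    (hA : HasBlock 𝕜 𝓕 w p γ A) {u : Finset ℕ+ → U} (hu1 : ∀ E, E.Nonempty → ‖u E‖ ≤ 1)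
    (hu : WeaklyNull 𝕜 u) {L : Set ℕ+} (hL : L.Infinite) :
    ∃ M ⊆ L, M.Infinite ∧ ∀ N ⊆ M, N.Infinite →
      weakNorm 𝕜 p (fun n => A (blockSum 𝕜 𝓕 w N u n)) ≤ γ := by
  -- Failure of the bound is witnessed by one functional and finitely many blocks, hence is open.
  -- The alternative that it always fails contradicts the property of `A`.
  obtain ⟨M, hML, hM, h⟩ := exists_homogeneous
    (O := fun N => ¬ weakNorm 𝕜 p (fun n => A (blockSum 𝕜 𝓕 w N u n)) ≤ γ) hL (by
      intro N hN hO
      simp only [weakNorm_le_iff, tsum_rpow_le_iff hp, not_forall] at hO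
      obtain ⟨f, hf, n, hn⟩ := hO
      obtain ⟨b, hb⟩ := h𝓕.cut_eq_of_agree hN n
      refine ⟨b, fun N' hN' hNN' hle => hn ?_⟩
      refine le_trans (le_of_eq ?_) ((tsum_rpow_le_iff hp).1 (weakNorm_le_iff.1 hle f hf) n)
      congr 1
      refine Finset.sum_congr rfl fun i hi => ?_
      have hi' : i + 1 ≤ n := Finset.mem_range.1 hi
      rw [blockSum, blockSum, hb N' hN' hNN' i (by omega), hb N' hN' hNN' (i + 1) hi'])
  refine ⟨M, hML, hM, ?_⟩
  rcases h with h | h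
  · obtain ⟨N, hNM, hN, hle⟩ := hA u hu1 hu M hM
    exact absurd hle (h N hNM hN)
  · exact fun N hN hNi => not_not.1 (h N hN hNi)

theorem HasBlock.add (h𝓕 : Regular 𝓕) (hp : 1 ≤ p) {A B : U →L[𝕜] V} {γ γ' : ℝ≥0}
    (hA : HasBlock 𝕜 𝓕 w p γ A) (hB : HasBlock 𝕜 𝓕 w p γ' B) :
    HasBlock 𝕜 𝓕 w p (γ + γ') (A + B) := by
  intro u hu1 hu L hL
  obtain ⟨M, hML, hM, h⟩ := hA.exists_forall h𝓕 (zero_lt_one.trans_le hp) hu1 hu hL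
  obtain ⟨N, hNM, hN, h'⟩ := hB u hu1 hu M hM
  refine ⟨N, hNM.trans hML, hN, (weakNorm_add_le hp _ _).trans ?_⟩
  rw [ENNReal.coe_add]
  exact add_le_add (h N hNM hN) h'

theorem HasBlock.zero (hp : 0 < p) : HasBlock 𝕜 𝓕 w p 0 (0 : U →L[𝕜] V) :=
  fun _ _ _ L hL => ⟨L, subset_rfl, hL, by simp [weakNorm_zero hp]⟩

theorem HasBlock.comp (hp : 0 < p) (A : V →L[𝕜] W) {B : U →L[𝕜] V} (C : T →L[𝕜] U)
    (hB : HasBlock 𝕜 𝓕 w p γ B) : HasBlock 𝕜 𝓕 w p (‖A‖₊ * γ * ‖C‖₊) ((A.comp B).comp C) := by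
  intro u hu1 hu L hL
  -- Normalizing keeps the collection in the unit ball. For `C = 0` the convention `0⁻¹ = 0` gives
  -- `D = 0`.
  let D : T →L[𝕜] U := (((‖C‖ : ℝ) : 𝕜)⁻¹) • C
  have hD : ‖D‖ ≤ 1 := by
    rw [norm_smul, norm_inv, RCLike.norm_ofReal, abs_norm]
    exact inv_mul_le_one
  have hCD (x : T) : C x = ((‖C‖ : ℝ) : 𝕜) • D x := by
    rcases eq_or_ne C 0 with h0 | h0
    · simp [h0]
    · simp only [D, _root_.smul_apply]
      rw [smul_inv_smul₀]
      exact_mod_cast norm_ne_zero_iff.2 h0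
  obtain ⟨M, hML, hM, h⟩ := hB (fun E => D (u E))
    (fun E hE => (D.le_opNorm _).trans (mul_le_one₀ hD (norm_nonneg _) (hu1 E hE)))
    (fun F f => hu F (f.comp D)) L hL
  refine ⟨M, hML, hM, ?_⟩
  have e : (fun n => ((A.comp B).comp C) (blockSum 𝕜 𝓕 w M u n)) =
      fun n => (((‖C‖ : ℝ) : 𝕜) • A) (B (blockSum 𝕜 𝓕 w M (fun E => D (u E)) n)) := by
    ext n
    simp only [ContinuousLinearMap.comp_apply, hCD, map_smul, map_blockSum D, _root_.smul_apply]
  rw [e]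
  refine (weakNorm_comp_le hp _ _).trans ?_
  push_cast
  have e2 : ‖((‖C‖ : ℝ) : 𝕜) • A‖ₑ = ‖C‖ₑ * ‖A‖ₑ := by
    rw [enorm_smul]
    congr 1
    simp [enorm_eq_nnnorm]
  rw [e2, mul_comm ‖C‖ₑ, mul_right_comm]
  exact mul_le_mul_left (mul_le_mul_right h _) _

theorem HasBlock.of_embedding (hp : 0 < p) {A : U →L[𝕜] V} {j : V →L[𝕜] W}
    (hj : IsIsomorphicEmbedding j) (h : ∃ γ, HasBlock 𝕜 𝓕 w p γ (j.comp A)) :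
    ∃ γ, HasBlock 𝕜 𝓕 w p γ A := by
  obtain ⟨δ, hδ, hj⟩ := hj
  obtain ⟨γ, h⟩ := h
  refine ⟨(δ⁻¹).toNNReal * γ, fun u hu1 hu L hL => ?_⟩
  obtain ⟨M, hML, hM, h⟩ := h u hu1 hu L hL
  refine ⟨M, hML, hM, (weakNorm_le_of_embedding hp hδ hj _).trans ?_⟩
  rw [ENNReal.coe_mul]
  exact mul_le_mul_right h _

/-! ## Compact operators -/

/-- The images eventually lie in a compact set, and every functional vanishes at each of their
cluster points. -/
theorem tendsto_zero_of_isCompactOperator {A : U →L[𝕜] V} (hA : IsCompactOperator A) {v : ℕ+ → U}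
    {C : ℝ} (hC : ∀ᶠ k in atTop, ‖v k‖ ≤ C)
    (hv : ∀ f : U →L[𝕜] 𝕜, Tendsto (fun k => f (v k)) atTop (𝓝 0)) :
    Tendsto (fun k => A (v k)) atTop (𝓝 0) := by
  obtain ⟨K, hK, hAK⟩ := IsCompactOperator.image_closedBall_subset_compact
    (f := (A : U →ₗ[𝕜] V)) hA C
  refine hK.tendsto_nhds_of_unique_mapClusterPt
    (hC.mono fun k hk => hAK ⟨v k, by simpa using hk, rfl⟩) fun y _ hy => ?_
  refine SeparatingDual.eq_zero_of_forall_dual_eq_zero (R := 𝕜) fun f => ?_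
  have h1 : MapClusterPt (f y) atTop (f ∘ fun k => A (v k)) :=
    hy.continuousAt_comp f.continuous.continuousAt
  exact @eq_of_nhds_neBot _ _ _ _ _ (h1.neBot.mono (inf_le_inf_left _ (hv (f.comp A))))

theorem sum_Ioc_half_pow {a b : ℕ} (hab : a ≤ b) :
    ∑ j ∈ Finset.Ioc a b, (1 / 2 : ℝ) ^ j = (1 / 2) ^ a - (1 / 2) ^ b := by
  induction b, hab using Nat.le_induction with
  | base => simp
  | succ b hab ih =>
    rw [← Finset.insert_Ioc_right_eq_Ioc_add_one hab, Finset.sum_insert (by simp), ih, pow_succ]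
    ring

theorem ProperInitSeg.card_lt {E F : Finset ℕ+} (h : ProperInitSeg E F) : E.card < F.card :=
  Finset.card_lt_card (Finset.ssubset_iff_subset_ne.2 ⟨h.1.1, h.2⟩)

theorem InitSeg.eq_of_card_eq {E F G : Finset ℕ+} (hE : InitSeg E G) (hF : InitSeg F G)
    (h : E.card = F.card) : E = F := by
  by_cases hsub : E ⊆ F
  · exact Finset.eq_of_subset_of_card_le hsub h.ge
  · obtain ⟨a, haE, haF⟩ := Finset.not_subset.1 hsub
    refine (Finset.eq_of_subset_of_card_le (fun b hb => hE.2 a haE b (hF.1 hb) ?_) h.le).symm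
    by_contra! hab
    exact haF (hF.2 b hb a (hE.1 haE) hab.le)

open Classical in
-- The `E` in one block are initial segments of the same set, so their sizes are distinct and a
-- geometric sum bounds the block. The bound is a difference so that it telescopes over blocks.
theorem norm_blockSum_le (hw : ∀ E, |w E| ≤ 1) {M : Set ℕ+} {v : Finset ℕ+ → V} {n : ℕ}
    (hv : ∀ E : Finset ℕ+, E.Nonempty → E ⊆ cut 𝓕 M (n + 1) → ‖v E‖ ≤ (1 / 2) ^ E.card) :
    ‖blockSum 𝕜 𝓕 w M v n‖ ≤
      (1 / 2) ^ (cut 𝓕 M n).card - (1 / 2) ^ (cut 𝓕 M (n + 1)).card := by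
  rw [← sum_Ioc_half_pow (Finset.card_le_card (cut_mono 𝓕 M (Nat.le_succ n)))]
  refine (norm_sum_le _ _).trans ?_
  refine (Finset.sum_le_sum (g := fun E => (1 / 2 : ℝ) ^ E.card) fun E hE => ?_).trans ?_
  · obtain ⟨hE1, hE2, -⟩ := Finset.mem_filter.1 hE
    rw [norm_smul, RCLike.norm_ofReal]
    exact (mul_le_of_le_one_left (norm_nonneg _) (hw E)).trans
      (hv E hE2.nonempty (Finset.mem_powerset.1 hE1))
  · rw [← Finset.sum_image (s := Finset.filter _ _) (g := Finset.card)
      (f := fun j => (1 / 2 : ℝ) ^ j)]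
    · refine Finset.sum_le_sum_of_subset_of_nonneg (fun j hj => ?_) fun _ _ _ => by positivity
      obtain ⟨E, hE, rfl⟩ := Finset.mem_image.1 hj
      obtain ⟨hE1, hE2, hE3⟩ := Finset.mem_filter.1 hE
      exact Finset.mem_Ioc.2 ⟨ProperInitSeg.card_lt hE2, Finset.card_le_card hE3.1⟩
    · intro E hE F hF h
      exact InitSeg.eq_of_card_eq (Finset.mem_filter.1 hE).2.2 (Finset.mem_filter.1 hF).2.2 h

theorem HasBlock.of_isCompactOperator (h𝓕 : Regular 𝓕) (hp : 1 ≤ p) (hw : ∀ E, |w E| ≤ 1)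
    {A : U →L[𝕜] V} (hA : IsCompactOperator A) : HasBlock 𝕜 𝓕 w p 1 A := by
  intro u hu1 hu L hL
  obtain ⟨M, hML, hM, h⟩ := exists_fusion (L := L)
    (R := fun s M => ∀ n ∈ M, ‖A (u (insert n s))‖ ≤ (1 / 2) ^ (s.card + 1)) hL
    (fun s M M' h hM n hn => hM n (h hn)) (fun s N _ hN => by
      have htend := (tendsto_zero_of_isCompactOperator hA (v := fun k => u (insert k s))
        (.of_forall fun k => hu1 _ (Finset.insert_nonempty _ _)) (hu s)).norm
      rw [norm_zero] at htend
      obtain ⟨b, hb⟩ := eventually_atTop.1 (htend.eventually_le_const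
        (show (0 : ℝ) < (1 / 2) ^ (s.card + 1) by positivity))
      refine ⟨_, fun x hx => hx.1, infinite_inter_above hN {b}, fun n hn => hb n ?_⟩
      exact (hn.2 b (Finset.mem_singleton_self b)).le)
  have hsmall (E : Finset ℕ+) (hE : E.Nonempty) (hEM : ↑E ⊆ M) :
      ‖A (u E)‖ ≤ (1 / 2) ^ E.card := by
    have hmax := E.max'_mem hE
    have := h (E.erase (E.max' hE)) (fun k hk => hEM (Finset.mem_of_mem_erase hk)) (E.max' hE)
      ⟨hEM hmax, fun k hk => E.lt_max'_of_mem_erase_max' hE hk⟩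
    rwa [Finset.insert_erase hmax, Finset.card_erase_add_one hmax] at this
  refine ⟨M, hML, hM, weakNorm_le_one_of_sum_norm_le hp fun n => ?_⟩
  simp only [map_blockSum]
  refine (Finset.sum_le_sum fun i _ => norm_blockSum_le hw fun E hE hEM => hsmall E hE
    ((Finset.coe_subset.2 hEM).trans (h𝓕.cut_subset hM _))).trans ?_
  rw [Finset.sum_range_sub' fun n => (1 / 2 : ℝ) ^ (cut 𝓕 M n).card]
  have h0 : (cut 𝓕 M 0).card = 0 := by simp [cut]
  rw [h0, pow_zero]
  exact sub_le_self _ (by positivity)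

theorem isCompactOperator_of_finiteDimensional_range (A : U →L[𝕜] V)
    (h : FiniteDimensional 𝕜 (LinearMap.range (A : U →ₗ[𝕜] V))) : IsCompactOperator A := by
  have := FiniteDimensional.proper_rclike 𝕜 (LinearMap.range (A : U →ₗ[𝕜] V))
  let B : U →L[𝕜] LinearMap.range (A : U →ₗ[𝕜] V) := A.codRestrict _ fun x => ⟨x, rfl⟩
  have hB : IsCompactOperator B := isCompactOperator_of_locallyCompactSpace_dom B
  exact hB.clm_comp (Submodule.subtypeL _)

end Banach

/-! ## Lifting weakly null collections -/

section Lifting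

variable {𝕜 : Type*} [RCLike 𝕜]
variable {U : Type*} [NormedAddCommGroup U] [NormedSpace 𝕜 U]
variable {V : Type*} [NormedAddCommGroup V] [NormedSpace 𝕜 V]
variable {X : Type*} [NormedAddCommGroup X] [NormedSpace 𝕜 X]

/-- Mazur's theorem for the image of a sequence under an operator. -/
theorem exists_convex_norm_lt [NormedSpace ℝ X] [IsScalarTower ℝ 𝕜 X] (Q : X →L[𝕜] U)
    {x : ℕ+ → X} (hx : ∀ f : U →L[𝕜] 𝕜, Tendsto (fun k => f (Q (x k))) atTop (𝓝 0))
    {S : Set ℕ+} (hS : S.Infinite) {ε : ℝ} (hε : 0 < ε) :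
    ∃ w ∈ convexHull ℝ (x '' S), ‖Q w‖ < ε := by
  let _ : NormedSpace ℝ U := NormedSpace.restrictScalars ℝ 𝕜 U
  have : IsScalarTower ℝ 𝕜 U := RestrictScalars.isScalarTower ℝ 𝕜 U
  have h0 : (0 : U) ∈ closure (convexHull ℝ ((Q : X → U) '' (x '' S))) := by
    by_contra h0
    obtain ⟨f, r, hr, hf⟩ := RCLike.geometric_hahn_banach_point_closed (𝕜 := 𝕜)
      (convex_convexHull ℝ _).closure isClosed_closure h0
    rw [map_zero, map_zero] at hr
    have h1 : ∀ᶠ k in atTop, RCLike.re (f (Q (x k))) < r := by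
      have := (RCLike.continuous_re.tendsto (0 : 𝕜)).comp (hx f)
      rw [map_zero] at this
      exact this.eventually_lt_const hr
    obtain ⟨b, hb⟩ := eventually_atTop.1 h1
    obtain ⟨k, hkS, hk⟩ := exists_mem_gt hS b
    exact lt_asymm (hb k hk.le)
      (hf _ (subset_closure (subset_convexHull ℝ _ ⟨_, ⟨k, hkS, rfl⟩, rfl⟩)))
  obtain ⟨v, hv, hdist⟩ := Metric.mem_closure_iff.1 h0 ε hε
  rw [dist_zero_left] at hdist
  have himage := LinearMap.image_convexHull ((Q : X →ₗ[𝕜] U).restrictScalars ℝ) (x '' S)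
  obtain ⟨w, hw, rfl⟩ : v ∈ ((Q : X →ₗ[𝕜] U).restrictScalars ℝ) '' convexHull ℝ (x '' S) :=
    himage ▸ hv
  exact ⟨w, hw, hdist⟩

/-- Take `y k = x k - w k + z k`. Here `w k` is a convex combination of later terms along `M`, so it
has the same limit under every functional; Mazur makes `Q (w k)` small, and `z k` is a small lift of
it that restores `Q (x k)`. Each summand has norm at most `C`. -/
theorem exists_weaklyNull_correction {Q : X →L[𝕜] U} {C : ℝ}
    (hQ : ∀ v, ∃ x, Q x = v ∧ ‖x‖ ≤ C * ‖v‖) (hC : 0 < C) {x : ℕ+ → X} {M : Set ℕ+}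
    (hM : M.Infinite) (hxC : ∀ k, ‖x k‖ ≤ C)
    (hxQ : ∀ f : U →L[𝕜] 𝕜, Tendsto (fun k => f (Q (x k))) atTop (𝓝 0))
    (hx : ∀ f : X →L[𝕜] 𝕜, ∃ a, Tendsto (fun k => f (x k)) (atTop ⊓ 𝓟 M) (𝓝 a)) :
    ∃ y : ℕ+ → X, (∀ k, ‖y k‖ ≤ 3 * C) ∧ (∀ k, Q (y k) = Q (x k)) ∧
      ∀ f : X →L[𝕜] 𝕜, Tendsto (fun k => f (y k)) (atTop ⊓ 𝓟 M) (𝓝 0) := by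
  let _ : NormedSpace ℝ X := NormedSpace.restrictScalars ℝ 𝕜 X
  have : IsScalarTower ℝ 𝕜 X := RestrictScalars.isScalarTower ℝ 𝕜 X
  choose w hw hwQ using fun k : ℕ+ => exists_convex_norm_lt Q hxQ
    (infinite_inter_above hM {k}) (ε := ((k : ℕ) : ℝ)⁻¹) (by have := k.pos; positivity)
  choose z hzQ hz using fun k => hQ (Q (w k))
  have hwC (k : ℕ+) : ‖w k‖ ≤ C := by
    have : convexHull ℝ (x '' {n ∈ M | ∀ j ∈ ({k} : Finset ℕ+), j < n}) ⊆
        Metric.closedBall 0 C := by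
      refine convexHull_min ?_ (convex_closedBall _ _)
      rintro _ ⟨n, -, rfl⟩
      simpa using hxC n
    simpa using this (hw k)
  have hzk (k : ℕ+) : ‖z k‖ ≤ C * ((k : ℕ) : ℝ)⁻¹ :=
    (hz k).trans (mul_le_mul_of_nonneg_left (hwQ k).le hC.le)
  have hzC (k : ℕ+) : ‖z k‖ ≤ C := (hzk k).trans (mul_le_of_le_one_right hC.le
    (inv_le_one_of_one_le₀ (by exact_mod_cast k.pos)))
  refine ⟨fun k => x k - w k + z k, fun k => ?_, fun k => ?_, fun f => ?_⟩
  · refine (norm_add_le _ _).trans ?_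
    linarith [norm_sub_le (x k) (w k), hxC k, hwC k, hzC k]
  · rw [map_add, map_sub, hzQ, sub_add_cancel]
  · obtain ⟨a, ha⟩ := hx f
    have hwa : Tendsto (fun k => f (w k)) (atTop ⊓ 𝓟 M) (𝓝 a) := by
      refine tendsto_inf_left ?_
      rw [Metric.nhds_basis_closedBall.tendsto_right_iff]
      intro ε hε
      have h1 := ha.eventually (Metric.closedBall_mem_nhds a hε)
      rw [eventually_inf_principal] at h1
      obtain ⟨b, hb⟩ := eventually_atTop.1 h1
      refine eventually_atTop.2 ⟨b, fun k hk => ?_⟩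
      have hconv : Convex ℝ (((f : X →ₗ[𝕜] 𝕜).restrictScalars ℝ) ⁻¹' Metric.closedBall a ε) :=
        (convex_closedBall a ε).linear_preimage _
      refine convexHull_min ?_ hconv (hw k)
      rintro _ ⟨n, ⟨hnM, hn⟩, rfl⟩
      exact hb n (hk.trans (hn k (Finset.mem_singleton_self k)).le) hnM
    have hz0 : Tendsto z atTop (𝓝 0) := by
      refine squeeze_zero_norm hzk ?_
      rw [← mul_zero C]
      refine Tendsto.const_mul C (tendsto_inv_atTop_zero.comp ?_)
      exact tendsto_natCast_atTop_atTop.comp tendsto_PNat_val_atTop_atTop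
    have hfz : Tendsto (fun k => f (z k)) (atTop ⊓ 𝓟 M) (𝓝 0) := by
      have := (f.continuous.tendsto 0).comp hz0
      rw [map_zero] at this
      exact tendsto_inf_left this
    simpa using (ha.sub hwa).add hfz

/-- Weakly null collections lift through surjections from spaces not containing `ℓ₁`, after passing
to subsets. -/
theorem exists_weaklyNull_lift [CompleteSpace U] [CompleteSpace X] (hX : ¬ ContainsEllOne 𝕜 X)
    {Q : X →L[𝕜] U} (hQ : Function.Surjective Q) :
    ∃ C : ℝ≥0, 0 < C ∧ ∀ u : Finset ℕ+ → U, (∀ E, E.Nonempty → ‖u E‖ ≤ 1) → WeaklyNull 𝕜 u →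
      ∀ L : Set ℕ+, L.Infinite → ∃ M ⊆ L, M.Infinite ∧ ∃ y : Finset ℕ+ → X,
        (∀ E, E.Nonempty → ‖y E‖ ≤ C) ∧ WeaklyNull 𝕜 y ∧
        ∀ E : Finset ℕ+, E.Nonempty → ↑E ⊆ M → Q (y E) = u E := by
  classical
  obtain ⟨C, hC, hQC⟩ := Q.exists_preimage_norm_le hQ
  refine ⟨⟨3 * C, by positivity⟩, show (0 : ℝ) < 3 * C by positivity, fun u hu1 hu L hL => ?_⟩
  choose x hxQ hxC using fun E => hQC (u E)
  have hxC' (F : Finset ℕ+) (k : ℕ+) : ‖x (insert k F)‖ ≤ C := (hxC _).trans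
    (mul_le_of_le_one_right hC.le (hu1 _ (Finset.insert_nonempty _ _)))
  obtain ⟨M, hML, hM, hcauchy⟩ := exists_diagonal (L := L)
    (P := fun (F : Finset ℕ+) M => ∀ f : X →L[𝕜] 𝕜,
      ∃ a, Tendsto (fun k => f (x (insert k F))) (atTop ⊓ 𝓟 M) (𝓝 a)) hL
    (fun F M M' hfin h f => by
      obtain ⟨a, ha⟩ := h f
      refine ⟨a, ha.mono_left (le_inf inf_le_left (le_principal_iff.2 ?_))⟩
      rw [mem_inf_principal]
      obtain ⟨b, hb⟩ := hfin.bddAbove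
      filter_upwards [eventually_gt_atTop b] with k hk hkM'
      by_contra hkM
      exact (hb ⟨hkM', hkM⟩).not_gt hk)
    (fun F N _ hN => exists_weaklyCauchy hX (hxC' F) hN)
  choose y hyC hyQ hy using fun F : Finset ℕ+ => exists_weaklyNull_correction hQC hC hM (hxC' F)
    (fun f => by simpa only [hxQ] using hu F f) (hcauchy F)
  -- `E` is read as its maximum added to the rest. The value `0` off subsets of `M` turns
  -- convergence along `M` into convergence along all of `ℕ+`.
  let Y : Finset ℕ+ → X := fun E =>
    if h : E.Nonempty ∧ ↑E ⊆ M then y (E.erase (E.max' h.1)) (E.max' h.1) else 0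
  refine ⟨M, hML, hM, Y, fun E hE => ?_, fun F f => ?_, fun E hE hEM => ?_⟩
  · simp only [Y]
    split_ifs
    · exact hyC _ _
    · rw [norm_zero]
      exact NNReal.coe_nonneg _
  · by_cases hF : ↑F ⊆ M
    · have hlim := hy F f
      rw [Metric.nhds_basis_closedBall.tendsto_right_iff] at hlim ⊢
      intro ε hε
      have h1 := hlim ε hε
      rw [eventually_inf_principal] at h1
      filter_upwards [h1, eventually_gt_atTop (F.sup id ⊔ 1)] with k hk hkF
      have hlt : ∀ j ∈ F, j < k := fun j hj =>
        (le_sup_of_le_left (Finset.le_sup (f := id) hj)).trans_lt hkF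
      simp only [Y]
      split_ifs with h
      · have hkM : k ∈ M := h.2 (Finset.mem_coe.2 (Finset.mem_insert_self k F))
        have hmax : (insert k F).max' h.1 = k := by
          refine le_antisymm (Finset.max'_le _ _ _ fun j hj => ?_)
            (Finset.le_max' _ _ (Finset.mem_insert_self k F))
          rcases Finset.mem_insert.1 hj with rfl | hj
          · exact le_rfl
          · exact (hlt j hj).le
        rw [hmax, Finset.erase_insert fun hkF => lt_irrefl _ (hlt k hkF)]
        exact hk hkM
      · rw [map_zero]
        exact Metric.mem_closedBall_self hε.le
    · refine tendsto_const_nhds.congr fun k => ?_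
      have : ¬ ((insert k F).Nonempty ∧ ↑(insert k F) ⊆ M) := fun h =>
        hF ((Finset.coe_subset.2 (Finset.subset_insert k F)).trans h.2)
      simp only [Y, dif_neg this, map_zero]
  · simp only [Y, dif_pos (And.intro hE hEM)]
    rw [hyQ, hxQ, Finset.insert_erase (E.max'_mem hE)]

variable {𝓕 : Set (Finset ℕ+)} {w : Finset ℕ+ → ℝ} {p : ℝ}

/-- Block sums along `N ⊆ M` only involve subsets of `M`, where the lift is exact. Rescaling the
lift to the unit ball costs the factor `C`. -/
theorem HasBlock.of_surjective [CompleteSpace U] [CompleteSpace X] (h𝓕 : Regular 𝓕) (hp : 0 < p)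
    (hX : ¬ ContainsEllOne 𝕜 X) {A : U →L[𝕜] V} {Q : X →L[𝕜] U} (hQ : Function.Surjective Q)
    (h : ∃ γ, HasBlock 𝕜 𝓕 w p γ (A.comp Q)) : ∃ γ, HasBlock 𝕜 𝓕 w p γ A := by
  obtain ⟨C, hC, hlift⟩ := exists_weaklyNull_lift hX hQ
  obtain ⟨γ, h⟩ := h
  refine ⟨C * γ, fun u hu1 hu L hL => ?_⟩
  obtain ⟨M, hML, hM, y, hyC, hy, hyQ⟩ := hlift u hu1 hu L hL
  have hC' : ((C : ℝ) : 𝕜) ≠ 0 := by exact_mod_cast hC.ne'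
  obtain ⟨N, hNM, hN, hle⟩ := h (fun E => ((C : ℝ) : 𝕜)⁻¹ • y E)
    (fun E hE => by
      rw [norm_smul, norm_inv, RCLike.norm_ofReal, NNReal.abs_eq,
        inv_mul_le_one₀ (NNReal.coe_pos.2 hC)]
      exact hyC E hE)
    (fun F f => by
      simpa only [map_smul, smul_zero] using (hy F f).const_smul (((C : ℝ) : 𝕜)⁻¹))
    M hM
  refine ⟨N, hNM.trans hML, hN, ?_⟩
  have e : (fun n => A (blockSum 𝕜 𝓕 w N u n)) = fun n => (((C : ℝ) : 𝕜) • .id 𝕜 V : V →L[𝕜] V)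
      ((A.comp Q) (blockSum 𝕜 𝓕 w N (fun E => ((C : ℝ) : 𝕜)⁻¹ • y E) n)) := by
    ext n
    rw [blockSum_smul, map_smul, _root_.smul_apply, ContinuousLinearMap.id_apply, smul_inv_smul₀ hC',
      ContinuousLinearMap.comp_apply, map_blockSum Q,
      h𝓕.blockSum_congr w hN fun E hE hEN => (hyQ E hE (hEN.trans hNM)).symm]
  rw [e]
  refine (weakNorm_comp_le hp _ _).trans ?_
  rw [ENNReal.coe_mul]
  refine mul_le_mul' ?_ hle
  rw [enorm_smul]
  have h1 : ‖((C : ℝ) : 𝕜)‖ₑ = C := by simp [enorm_eq_nnnorm]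
  rw [h1]
  refine mul_le_of_le_one_right bot_le ?_
  rw [← ofReal_norm, ENNReal.ofReal_le_one]
  exact ContinuousLinearMap.norm_id_le

end Lifting

/-! ## The associated ideal norm and permanence properties -/

section Ideal

variable {𝕜 : Type*} [RCLike 𝕜]
variable {T : Type*} [NormedAddCommGroup T] [NormedSpace 𝕜 T]
variable {U : Type*} [NormedAddCommGroup U] [NormedSpace 𝕜 U]
variable {V : Type*} [NormedAddCommGroup V] [NormedSpace 𝕜 V]
variable {W : Type*} [NormedAddCommGroup W] [NormedSpace 𝕜 W]

/-- The infimum of the constants for which the property holds. -/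
def blockNorm (𝓕 : Set (Finset ℕ+)) (w : Finset ℕ+ → ℝ) (p : ℝ) (A : U →L[𝕜] V) : ℝ≥0∞ :=
  ⨅ γ : ℝ≥0, ⨅ _ : HasBlock 𝕜 𝓕 w p γ A, (γ : ℝ≥0∞)

variable {𝓕 : Set (Finset ℕ+)} {w : Finset ℕ+ → ℝ} {p : ℝ}

theorem blockNorm_le {γ : ℝ≥0} {A : U →L[𝕜] V} (h : HasBlock 𝕜 𝓕 w p γ A) :
    blockNorm 𝓕 w p A ≤ γ :=
  iInf₂_le γ h

theorem blockNorm_add_le (h𝓕 : Regular 𝓕) (hp : 1 ≤ p) (A B : U →L[𝕜] V) :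
    blockNorm 𝓕 w p (A + B) ≤ blockNorm 𝓕 w p A + blockNorm 𝓕 w p B := by
  rw [blockNorm.eq_1 _ _ _ A, blockNorm.eq_1 _ _ _ B]
  simp only [ENNReal.iInf_add, ENNReal.add_iInf]
  refine le_iInf₂ fun γ' hB => le_iInf₂ fun γ hA => (blockNorm_le (hA.add h𝓕 hp hB)).trans ?_
  rw [ENNReal.coe_add]

theorem blockNorm_zero (hp : 0 < p) : blockNorm 𝓕 w p (0 : U →L[𝕜] V) = 0 :=
  le_antisymm ((blockNorm_le (HasBlock.zero hp)).trans ENNReal.coe_zero.le) bot_le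

theorem blockNorm_comp_le (hp : 0 < p) (A : V →L[𝕜] W) (B : U →L[𝕜] V) (C : T →L[𝕜] U) :
    blockNorm 𝓕 w p ((A.comp B).comp C) ≤ ‖A‖ₑ * blockNorm 𝓕 w p B * ‖C‖ₑ := by
  -- Zero factors are treated apart: the infimum may be `∞`, and only non-zero finite factors are
  -- moved inside it.
  rcases eq_or_ne A 0 with rfl | hA
  · simp [blockNorm_zero hp]
  rcases eq_or_ne C 0 with rfl | hC
  · simp [blockNorm_zero hp]
  have hA' : ‖A‖ₑ ≠ 0 := by simpa [enorm_eq_nnnorm] using hA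
  have hC' : ‖C‖ₑ ≠ 0 := by simpa [enorm_eq_nnnorm] using hC
  rw [blockNorm.eq_1 _ _ _ B]
  simp only [ENNReal.mul_iInf_of_ne hA' enorm_ne_top,
    ENNReal.iInf_mul_of_ne hC' enorm_ne_top]
  refine le_iInf₂ fun γ hB => (blockNorm_le (hB.comp hp A C)).trans ?_
  push_cast
  exact le_rfl

theorem HasBlock.exists_smul (hp : 0 < p) (a : 𝕜) {A : U →L[𝕜] V}
    (h : ∃ γ, HasBlock 𝕜 𝓕 w p γ A) : ∃ γ, HasBlock 𝕜 𝓕 w p γ (a • A) := by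
  obtain ⟨γ, h⟩ := h
  have e : ((a • ContinuousLinearMap.id 𝕜 V).comp A).comp (.id 𝕜 U) = a • A := by ext; simp
  exact ⟨_, e ▸ h.comp hp (a • ContinuousLinearMap.id 𝕜 V) (.id 𝕜 U)⟩

theorem HasBlock.exists_comp (hp : 0 < p) (A : V →L[𝕜] W) {B : U →L[𝕜] V} (C : T →L[𝕜] U)
    (h : ∃ γ, HasBlock 𝕜 𝓕 w p γ B) : ∃ γ, HasBlock 𝕜 𝓕 w p γ ((A.comp B).comp C) := by
  obtain ⟨γ, h⟩ := h
  exact ⟨_, h.comp hp A C⟩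

theorem HasBlock.exists_of_equiv (hp : 0 < p) (e : U ≃L[𝕜] V)
    (h : ∃ γ, HasBlock 𝕜 𝓕 w p γ (ContinuousLinearMap.id 𝕜 U)) :
    ∃ γ, HasBlock 𝕜 𝓕 w p γ (ContinuousLinearMap.id 𝕜 V) := by
  convert HasBlock.exists_comp hp (e : U →L[𝕜] V) (e.symm : V →L[𝕜] U) h
  ext v
  simp

theorem not_containsEllOne_submodule (hU : ¬ ContainsEllOne 𝕜 U) (Y : Submodule 𝕜 U) :
    ¬ ContainsEllOne 𝕜 Y := by
  rintro ⟨j, δ, hδ, hj⟩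
  exact hU ⟨Y.subtypeL.comp j, δ, hδ, hj⟩

/-- `Z` is a quotient of its preimage `P` in `U`. The closed subspace `P` inherits both the property
and the absence of `ℓ₁`, so the surjection result applies to `P → Z`. -/
theorem HasBlock.exists_subquotient [CompleteSpace U] (h𝓕 : Regular 𝓕) (hp : 0 < p)
    (Y : Submodule 𝕜 U) [IsClosed (Y : Set U)] (Z : Submodule 𝕜 (U ⧸ Y))
    (hZ : IsClosed (Z : Set (U ⧸ Y))) (hU : ¬ ContainsEllOne 𝕜 U)
    (h : ∃ γ, HasBlock 𝕜 𝓕 w p γ (ContinuousLinearMap.id 𝕜 U)) :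
    ∃ γ, HasBlock 𝕜 𝓕 w p γ (ContinuousLinearMap.id 𝕜 Z) := by
  let q : U →L[𝕜] U ⧸ Y := Y.mkQL
  let P : Submodule 𝕜 U := Z.comap (q : U →ₗ[𝕜] U ⧸ Y)
  have hP : IsClosed (P : Set U) := hZ.preimage q.continuous
  have : CompleteSpace P := hP.completeSpace_coe
  have : CompleteSpace Z := hZ.completeSpace_coe
  let r : P →L[𝕜] Z := (q.comp P.subtypeL).codRestrict Z fun x => x.2
  have hr : Function.Surjective r := by
    rintro ⟨z, hz⟩
    obtain ⟨x, rfl⟩ := Submodule.Quotient.mk_surjective Y z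
    exact ⟨⟨x, hz⟩, rfl⟩
  have hPid : ∃ γ, HasBlock 𝕜 𝓕 w p γ (ContinuousLinearMap.id 𝕜 P) := by
    refine HasBlock.of_embedding hp (j := P.subtypeL) ⟨1, one_pos, fun x => by simp⟩ ?_
    have e : ((ContinuousLinearMap.id 𝕜 U).comp (.id 𝕜 U)).comp P.subtypeL =
        P.subtypeL.comp (.id 𝕜 P) := by ext; simp
    exact e ▸ HasBlock.exists_comp hp (.id 𝕜 U) P.subtypeL h
  refine HasBlock.of_surjective h𝓕 hp (not_containsEllOne_submodule hU P) hr ?_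
  have e : (r.comp (.id 𝕜 P)).comp (.id 𝕜 P) = (ContinuousLinearMap.id 𝕜 Z).comp r := by
    ext; simp
  exact e ▸ HasBlock.exists_comp hp r (.id 𝕜 P) hPid

end Ideal

theorem isOperatorIdeal_hasBlock {𝕜 : Type*} [RCLike 𝕜] {𝓕 : Set (Finset ℕ+)} (h𝓕 : Regular 𝓕)
    {w : Finset ℕ+ → ℝ} (hw : ∀ E, |w E| ≤ 1) {p : ℝ} (hp : 1 ≤ p) :
    IsOperatorIdeal (𝕜 := 𝕜) fun _ _ => {A | ∃ γ, HasBlock 𝕜 𝓕 w p γ A} where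
  finiteRank_mem U V _ _ _ _ _ _ A hA :=
    ⟨1, .of_isCompactOperator h𝓕 hp hw (isCompactOperator_of_finiteDimensional_range A hA)⟩
  add_mem U V _ _ _ _ _ _ A B hA hB := by
    obtain ⟨γ, hA⟩ := hA
    obtain ⟨γ', hB⟩ := hB
    exact ⟨γ + γ', hA.add h𝓕 hp hB⟩
  smul_mem U V _ _ _ _ _ _ a A hA := HasBlock.exists_smul (zero_lt_one.trans_le hp) a hA
  comp_mem T U V W _ _ _ _ _ _ _ _ _ _ _ _ A B C hB :=
    HasBlock.exists_comp (zero_lt_one.trans_le hp) A C hB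

theorem abs_weight₂_le_one (c : FundamentalSequences) (ξ ζ : Ordinal) (E : Finset ℕ+) :
    |qWeight c ξ ζ E * pWeight c ξ E| ≤ 1 := by
  rw [abs_mul]
  exact mul_le_one₀ (abs_qWeight_le_one c ξ ζ E) (abs_nonneg _) (abs_pWeight_le_one c ξ E)

end RepeatedAverages

end

theorem mainTheorem10 {𝕜 : Type*} [RCLike 𝕜]
    (c : FundamentalSequences) (hc : c.IsNested)
    (ξ ζ : Ordinal.{0}) (hξ : ξ < ω₁) (hζ : ζ < ω₁) :
    -- the triangle inequality and the ideal inequality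
    (∀ (U : Type u) (V : Type v) [NormedAddCommGroup U] [NormedSpace 𝕜 U] [CompleteSpace U]
        [NormedAddCommGroup V] [NormedSpace 𝕜 V] [CompleteSpace V] (A B : U →L[𝕜] V),
        sNorm c ξ (A + B) ≤ sNorm c ξ A + sNorm c ξ B ∧
        gNorm c ξ ζ (A + B) ≤ gNorm c ξ ζ A + gNorm c ξ ζ B) ∧
    (∀ (T U V W : Type u) [NormedAddCommGroup T] [NormedSpace 𝕜 T] [CompleteSpace T]
        [NormedAddCommGroup U] [NormedSpace 𝕜 U] [CompleteSpace U]
        [NormedAddCommGroup V] [NormedSpace 𝕜 V] [CompleteSpace V]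
        [NormedAddCommGroup W] [NormedSpace 𝕜 W] [CompleteSpace W]
        (A : V →L[𝕜] W) (B : U →L[𝕜] V) (C : T →L[𝕜] U),
        sNorm c ξ ((A.comp B).comp C) ≤ ‖A‖ₑ * sNorm c ξ B * ‖C‖ₑ ∧
        gNorm c ξ ζ ((A.comp B).comp C) ≤ ‖A‖ₑ * gNorm c ξ ζ B * ‖C‖ₑ) ∧
    -- operator ideals
    IsOperatorIdeal.{u} (𝕜 := 𝕜) (fun U V => classS 𝕜 c ξ U V) ∧
    IsOperatorIdeal.{u} (𝕜 := 𝕜) (fun U V => classG 𝕜 c ξ ζ U V) ∧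
    -- containing the compact operators
    (∀ (U : Type u) (V : Type v) [NormedAddCommGroup U] [NormedSpace 𝕜 U] [CompleteSpace U]
        [NormedAddCommGroup V] [NormedSpace 𝕜 V] [CompleteSpace V] (A : U →L[𝕜] V),
        IsCompactOperator A → A ∈ classS 𝕜 c ξ U V ∧ A ∈ classG 𝕜 c ξ ζ U V) ∧
    -- surjections from spaces not containing `ℓ₁`
    (∀ (U : Type u) (V : Type v) (X : Type w)
        [NormedAddCommGroup U] [NormedSpace 𝕜 U] [CompleteSpace U]
        [NormedAddCommGroup V] [NormedSpace 𝕜 V] [CompleteSpace V]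
        [NormedAddCommGroup X] [NormedSpace 𝕜 X] [CompleteSpace X]
        (A : U →L[𝕜] V) (Q : X →L[𝕜] U), ¬ ContainsEllOne 𝕜 X → Function.Surjective Q →
        (A.comp Q ∈ classS 𝕜 c ξ X V → A ∈ classS 𝕜 c ξ U V) ∧
        (A.comp Q ∈ classG 𝕜 c ξ ζ X V → A ∈ classG 𝕜 c ξ ζ U V)) ∧
    -- isomorphic embeddings
    (∀ (U : Type u) (V : Type v) (X : Type w)
        [NormedAddCommGroup U] [NormedSpace 𝕜 U] [CompleteSpace U]
        [NormedAddCommGroup V] [NormedSpace 𝕜 V] [CompleteSpace V]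
        [NormedAddCommGroup X] [NormedSpace 𝕜 X] [CompleteSpace X]
        (A : U →L[𝕜] V) (j : V →L[𝕜] X), IsIsomorphicEmbedding j →
        (j.comp A ∈ classS 𝕜 c ξ U X → A ∈ classS 𝕜 c ξ U V) ∧
        (j.comp A ∈ classG 𝕜 c ξ ζ U X → A ∈ classG 𝕜 c ξ ζ U V)) ∧
    -- isomorphic invariance
    (∀ (U : Type u) (V : Type v) [NormedAddCommGroup U] [NormedSpace 𝕜 U] [CompleteSpace U]
        [NormedAddCommGroup V] [NormedSpace 𝕜 V] [CompleteSpace V], (U ≃L[𝕜] V) →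
        (SpaceHasS 𝕜 c ξ U ↔ SpaceHasS 𝕜 c ξ V) ∧
        (SpaceHasG 𝕜 c ξ ζ U ↔ SpaceHasG 𝕜 c ξ ζ V)) ∧
    -- subspaces of quotients
    (∀ (X : Type u) [NormedAddCommGroup X] [NormedSpace 𝕜 X] [CompleteSpace X]
        (Y : Submodule 𝕜 X) [IsClosed (Y : Set X)]
        (Z : Submodule 𝕜 (X ⧸ Y)), IsClosed (Z : Set (X ⧸ Y)) → ¬ ContainsEllOne 𝕜 X →
        (SpaceHasS 𝕜 c ξ X → SpaceHasS 𝕜 c ξ Z) ∧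
        (SpaceHasG 𝕜 c ξ ζ X → SpaceHasG 𝕜 c ξ ζ Z)) := by
  have hS := regular_schreier c ξ
  have hG := regular_convolution c hS ζ
  have h2 : (1 : ℝ) ≤ 2 := one_le_two
  have h1 : (1 : ℝ) ≤ 1 := le_rfl
  have h2' : (0 : ℝ) < 2 := two_pos
  have h1' : (0 : ℝ) < 1 := one_pos
  -- Both properties unfold definitionally to `HasBlock`: with `𝓢_ξ`, the weights `p^ξ` and exponent
  -- `2`, and with `𝓢_ζ[𝓢_ξ]`, the product weights and exponent `1`.
  refine ⟨?_, ?_, ?_, ?_, ?_, ?_, ?_, ?_, ?_⟩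
  · intro U V _ _ _ _ _ _ A B
    exact ⟨blockNorm_add_le hS h2 A B, blockNorm_add_le hG h1 A B⟩
  · intro T U V W _ _ _ _ _ _ _ _ _ _ _ _ A B C
    exact ⟨blockNorm_comp_le h2' A B C, blockNorm_comp_le h1' A B C⟩
  · exact isOperatorIdeal_hasBlock hS (abs_pWeight_le_one c ξ) h2
  · exact isOperatorIdeal_hasBlock hG (abs_weight₂_le_one c ξ ζ) h1
  · intro U V _ _ _ _ _ _ A hA
    exact ⟨⟨1, HasBlock.of_isCompactOperator hS h2 (abs_pWeight_le_one c ξ) hA⟩,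
      ⟨1, HasBlock.of_isCompactOperator hG h1 (abs_weight₂_le_one c ξ ζ) hA⟩⟩
  · intro U V X _ _ _ _ _ _ _ _ _ A Q hX hQ
    exact ⟨HasBlock.of_surjective hS h2' hX hQ, HasBlock.of_surjective hG h1' hX hQ⟩
  · intro U V X _ _ _ _ _ _ _ _ _ A j hj
    exact ⟨HasBlock.of_embedding h2' hj, HasBlock.of_embedding h1' hj⟩
  · intro U V _ _ _ _ _ _ e
    exact ⟨⟨HasBlock.exists_of_equiv h2' e, HasBlock.exists_of_equiv h2' e.symm⟩,
      ⟨HasBlock.exists_of_equiv h1' e, HasBlock.exists_of_equiv h1' e.symm⟩⟩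
  · intro X _ _ _ Y _ Z hZ hX
    exact ⟨HasBlock.exists_subquotient hS h2' Y Z hZ hX,
      HasBlock.exists_subquotient hG h1' Y Z hZ hX⟩
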